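/- Let $A$ be an infinite Boolean algebra with Stone space $K$ (the space of ultrafilters of $A$; for $a\in A$ put $[a]=\{u\in K: a\in u\}$), and let $C(K)$ be the Banach space of real-valued continuous functions on $K$ with the supremum norm. Suppose that: 1. $K$ is separable and perfect; 2. every bounded linear operator $T:C(K)\to C(K)$ is of the form $T(g)=fg+S(g)$, where $f\in C(K)$ and $S$ is weakly compact; 3. $C(K)$ contains no isomorphic copy of $\ell_\infty$; 4. there are complementary elements $k_1,k_2\in A$ (so that $K$ is the disjoint union of the clopen sets $K_{1,*}=[k_1]$ and $K_{2,*}=[k_2]$), a dense subalgebra $B\subseteq A$ with $k_1,k_2\in B$ (dense: every nonzero element of $A$ is above a nonzero element of $B$), and an automorphism $j$ of $B$ with $j(k_1)=k_2$, $j(k_2)=k_1$ and $j^2=\mathrm{Id}_B$; 5. for every sequence $(a_n)_{n\in\mathbb N}$ of pairwise disjoint elements of $A$ there is an infinite $M\subseteq\mathbb N$ such that $\sup_{n\in M}a_n$ exists in $A$. Let $C=\{b\in B: j(b)=b\}$, and let $D_+$ be the Boolean algebra of all sequences $(a_n)_{n\in\mathbb N}$ in the product algebra $A^{\mathbb N}$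 such that $a_n\in C$ for all but finitely many $n$. Let $K_+$ be the Stone space of $D_+$, let $X_+=C(K_+)$ with the supremum norm, and let $Y_+=\{f\in X_+: f|K_{1,0}=0\}$, where $K_{1,0}\subseteq K_+$ is the clopen set of the ultrafilters of $D_+$ that contain the sequence $(k_1,\bot,\bot,\dots)$, $\bot$ being the least element of $A$. Then the Banach spaces $Y_+$ and $X_+$ are not isomorphic, i.e. there is no linear homeomorphism between them. -/

import Mathlib

open Filter Topology

/-- The Stone space of a Boolean algebra: the set of its ultrafilters. -/
@[ext]
structure StoneSpace (A : Type*) [BooleanAlgebra A] where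
  carrier : Set A
  top_mem : ⊤ ∈ carrier
  bot_notMem : ⊥ ∉ carrier
  mem_of_le : ∀ {a b : A}, a ∈ carrier → a ≤ b → b ∈ carrier
  inf_mem : ∀ {a b : A}, a ∈ carrier → b ∈ carrier → a ⊓ b ∈ carrier
  mem_or_compl_mem : ∀ a : A, a ∈ carrier ∨ aᶜ ∈ carrier

namespace StoneSpace

variable {A : Type*} [BooleanAlgebra A]

/-- The basic set `[a]` of all ultrafilters that contain `a`. -/
def basic (a : A) : Set (StoneSpace A) := {u | a ∈ u.carrier}

/-- The Stone topology has the sets `[a]` as a basis. -/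
instance : TopologicalSpace (StoneSpace A) :=
  TopologicalSpace.generateFrom (Set.range basic)

theorem isOpen_basic (a : A) : IsOpen (basic a) :=
  TopologicalSpace.isOpen_generateFrom_of_mem ⟨a, rfl⟩

theorem compl_mem_iff (u : StoneSpace A) (a : A) : aᶜ ∈ u.carrier ↔ a ∉ u.carrier := by
  refine ⟨fun h h' => u.bot_notMem ?_, fun h => (u.mem_or_compl_mem a).resolve_left h⟩
  simpa using u.inf_mem h' h

theorem basic_compl (a : A) : basic aᶜ = (basic a)ᶜ := by
  ext u
  exact u.compl_mem_iff a

theorem isClopen_basic (a : A) : IsClopen (basic a) := by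
  refine ⟨⟨?_⟩, isOpen_basic a⟩
  rw [← basic_compl]
  exact isOpen_basic _

instance : CompactSpace (StoneSpace A) := by
  refine ⟨isCompact_iff_ultrafilter_le_nhds.2 fun F _ => ?_⟩
  refine ⟨⟨{a | basic a ∈ F}, ?_, ?_, ?_, ?_, ?_⟩, Set.mem_univ _, ?_⟩
  · exact mem_of_superset univ_mem fun u _ => u.top_mem
  · intro h
    have h0 : basic (⊥ : A) = ∅ := Set.eq_empty_of_forall_notMem fun u hu => u.bot_notMem hu
    rw [Set.mem_ofPred_eq, h0] at h
    exact empty_notMem (F : Filter (StoneSpace A)) h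
  · intro a b ha hab
    exact mem_of_superset ha fun u hu => u.mem_of_le hu hab
  · intro a b ha hb
    exact mem_of_superset (inter_mem ha hb) fun u hu => u.inf_mem hu.1 hu.2
  · intro a
    rw [Set.mem_ofPred_eq, Set.mem_ofPred_eq, basic_compl]
    exact F.mem_or_compl_mem _
  · rw [TopologicalSpace.nhds_generateFrom]
    refine le_iInf₂ fun s hs => ?_
    obtain ⟨hu, a, rfl⟩ := hs
    exact le_principal_iff.2 hu

instance : T2Space (StoneSpace A) := by
  refine ⟨fun u v huv => ?_⟩
  have key : ∀ u v : StoneSpace A, ∀ a, a ∈ u.carrier → a ∉ v.carrier →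
      ∃ U V : Set (StoneSpace A), IsOpen U ∧ IsOpen V ∧ u ∈ U ∧ v ∈ V ∧ Disjoint U V := by
    intro u v a hu hv
    refine ⟨basic a, (basic a)ᶜ, isOpen_basic a, (isClopen_basic a).compl.isOpen, hu, hv, ?_⟩
    exact disjoint_compl_right
  by_contra hcon
  apply huv
  ext a
  constructor
  · intro hu
    by_contra hv
    exact hcon (key u v a hu hv)
  · intro hv
    by_contra hu
    obtain ⟨U, V, hU, hV, h1, h2, h3⟩ := key v u a hv hu
    exact hcon ⟨V, U, hV, hU, h2, h1, h3.symm⟩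

end StoneSpace

/-- A bounded linear operator is weakly compact if the image of the closed unit ball is
relatively compact in the weak topology. -/
def IsWeaklyCompactOperator {E F : Type*} [NormedAddCommGroup E] [NormedSpace ℝ E]
    [NormedAddCommGroup F] [NormedSpace ℝ F] (S : E →L[ℝ] F) : Prop :=
  IsCompact (closure (toWeakSpace ℝ F '' (S '' Metric.closedBall (0 : E) 1)))

/-- Every bounded operator on `C(K)` has the form `g ↦ f g + S g` with `f ∈ C(K)` and `S`
weakly compact. -/
def HasFewOperators (K : Type*) [TopologicalSpace K] [CompactSpace K] : Prop :=
  ∀ T : C(K, ℝ) →L[ℝ] C(K, ℝ), ∃ (f : C(K, ℝ)) (S : C(K, ℝ) →L[ℝ] C(K, ℝ)),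
    IsWeaklyCompactOperator S ∧ ∀ g : C(K, ℝ), T g = f * g + S g

/-- The Banach space `E` contains an isomorphic copy of `ℓ_∞`. -/
def ContainsLinfty (E : Type*) [NormedAddCommGroup E] [NormedSpace ℝ E] : Prop :=
  ∃ T : lp (fun _ : ℕ => ℝ) ⊤ →L[ℝ] E, IsEmbedding T

section Construction

variable {A : Type*} [BooleanAlgebra A]

/-- The algebra `C = {b ∈ B : j b = b}` of the fixed points of an automorphism `j` of a
subalgebra `B` of `A`, as a subalgebra of `A`. -/
def fixedAlgebra (B : BooleanSubalgebra A) (j : B ≃o B) : BooleanSubalgebra A where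
  carrier := {a | ∃ h : a ∈ B, j ⟨a, h⟩ = ⟨a, h⟩}
  supClosed' := by
    rintro a ⟨ha, ha'⟩ b ⟨hb, hb'⟩
    refine ⟨BooleanSubalgebra.sup_mem ha hb, ?_⟩
    have h := OrderIso.map_sup j (⟨a, ha⟩ : B) (⟨b, hb⟩ : B)
    rw [ha', hb'] at h
    exact h
  infClosed' := by
    rintro a ⟨ha, ha'⟩ b ⟨hb, hb'⟩
    refine ⟨BooleanSubalgebra.inf_mem ha hb, ?_⟩
    have h := OrderIso.map_inf j (⟨a, ha⟩ : B) (⟨b, hb⟩ : B)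
    rw [ha', hb'] at h
    exact h
  compl_mem' := by
    rintro a ⟨ha, ha'⟩
    refine ⟨BooleanSubalgebra.compl_mem ha, ?_⟩
    have h := map_compl' j ⟨a, ha⟩
    rw [ha'] at h
    exact h
  bot_mem' := ⟨BooleanSubalgebra.bot_mem, map_bot j⟩

/-- The algebra `D_+` of all sequences in `A` whose terms eventually belong to `C`
(a subalgebra of the product `D_∞` of countably many copies of `A`). -/
def Dplus (C : BooleanSubalgebra A) : BooleanSubalgebra (ℕ → A) where
  carrier := {a | ∃ m : ℕ, ∀ n > m, a n ∈ C}
  supClosed' := by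
    rintro a ⟨m, hm⟩ b ⟨k, hk⟩
    exact ⟨max m k, fun n hn => BooleanSubalgebra.sup_mem
      (hm n (lt_of_le_of_lt (le_max_left m k) hn)) (hk n (lt_of_le_of_lt (le_max_right m k) hn))⟩
  infClosed' := by
    rintro a ⟨m, hm⟩ b ⟨k, hk⟩
    exact ⟨max m k, fun n hn => BooleanSubalgebra.inf_mem
      (hm n (lt_of_le_of_lt (le_max_left m k) hn)) (hk n (lt_of_le_of_lt (le_max_right m k) hn))⟩
  compl_mem' := by
    rintro a ⟨m, hm⟩
    exact ⟨m, fun n hn => BooleanSubalgebra.compl_mem (hm n hn)⟩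
  bot_mem' := ⟨0, fun _ _ => BooleanSubalgebra.bot_mem⟩

/-- The element of `D_+` that is `a` in the coordinate `n` and `⊥` in all the others. -/
def Dplus.single (C : BooleanSubalgebra A) (n : ℕ) (a : A) : Dplus C :=
  ⟨Function.update ⊥ n a, n, fun k hk => by
    rw [Function.update_of_ne (ne_of_gt hk)]
    exact BooleanSubalgebra.bot_mem⟩

/-- The compact space `K_+`, the Stone space of `D_+`. -/
abbrev Kplus (C : BooleanSubalgebra A) : Type _ := StoneSpace (Dplus C)

/-- The Banach space `X_+ = C(K_+)` with the supremum norm. -/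
abbrev Xplus (C : BooleanSubalgebra A) : Type _ := C(Kplus C, ℝ)

/-- The subspace `Y_+` of the functions in `X_+` that vanish on the clopen set `K_{1,0}`, the
copy of `K_{1,*} = [k₁]` in the summand `K_0` of `K_+`. -/
def Yplus (C : BooleanSubalgebra A) (k₁ : A) : Submodule ℝ (Xplus C) where
  carrier := {f | ∀ x ∈ StoneSpace.basic (Dplus.single C 0 k₁), f x = 0}
  add_mem' := by
    intro f g hf hg x hx
    rw [ContinuousMap.add_apply, hf x hx, hg x hx, add_zero]
  zero_mem' := fun _ _ => rfl
  smul_mem' := by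
    intro c f hf x hx
    rw [ContinuousMap.smul_apply, hf x hx, smul_zero]

end Construction

/-!
Write `K` for the Stone space of `A` and let `C` be the algebra of fixed points of `j`. A function on
`K_+` is the same as a bounded sequence of functions on `K` which is asymptotically `C`-invariant,
that is, whose terms are asymptotically unable to separate two ultrafilters of `A` with the same
trace on `C` (`asympInv_coord`, `exists_coord_eq`). An operator `U` on `C(K_+)` is thus a matrix of
operators on `C(K)`, each of which is multiplication by a function `φ n m` plus a weakly compact
operator. Weakly compact operators are small on small clopen sets at all but finitely many points
(`IsWeaklyCompactOperator.exists_norm_le`), so for all but countably many ultrafilters `z` of `C` the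
scalar matrix `φ n m x`, with `x` any ultrafilter of `A` extending `z`, describes `U` near `x`
(`exists_symbol`). Its rows are bounded in `ℓ_1`, so it acts on `ℓ_∞`.

Two facts make these matrices useful; each holds for all but countably many `z`.

* The matrix of a product is the product of the matrices (`countable_not_mul`). What has to be excluded
  is a contribution from the part of `K_+` at infinity. Such a contribution would produce an operator
  from `ℓ_∞` to `C(K)` that does not send the unit vectors to a null sequence, and by Rosenthal's
  lemma such an operator fixes a copy of `ℓ_∞` (`finite_setOf_lt_norm_unit`). The suprema of
  subsequences of disjoint sequences in `A` enter through `exists_isLUB_approx`.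
* If `x` and `y` have the same trace `z`, then the `n`-th rows of the matrices at `x` and `y` become
  arbitrarily close in `ℓ_1` as `n` grows (`countable_not_eventually_tsum_le`), because the range of
  `U` consists of asymptotically invariant sequences.

Suppose that `T` is an isomorphism from `Y_+` onto `X_+`, and let `U` be the composition of `T` with the
projection of `X_+` onto `Y_+`. The algebra `C` is atomless, so by Baire's theorem some `z` avoids
all the countable exceptional sets, and `z` extends to `x` in `[k₁]` and to `y` in `[k₂]`. The matrix of
`U` at `y` is invertible, while that at `x` becomes invertible only after deletion of its `0`-th
column, so the two have different Fredholm indices. But they differ by finitely many rows and an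
operator of small norm, so their indices agree (`injective_of_perturbation`, `not_rows_close`).
-/

/-! ### Stone spaces -/

namespace StoneSpace

variable {A : Type*} [BooleanAlgebra A]

theorem basic_inf (a b : A) : basic (a ⊓ b) = basic a ∩ basic b := by
  ext u
  exact ⟨fun h => ⟨u.mem_of_le h inf_le_left, u.mem_of_le h inf_le_right⟩,
    fun h => u.inf_mem h.1 h.2⟩

theorem mem_sup_iff (u : StoneSpace A) (a b : A) :
    a ⊔ b ∈ u.carrier ↔ a ∈ u.carrier ∨ b ∈ u.carrier := by
  refine ⟨fun h => ?_, fun h => h.elim (fun h => u.mem_of_le h le_sup_left)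
    (fun h => u.mem_of_le h le_sup_right)⟩
  by_contra! hc
  have h1 := (u.compl_mem_iff a).2 hc.1
  have h2 := (u.compl_mem_iff b).2 hc.2
  apply u.bot_notMem
  have := u.inf_mem h (u.inf_mem h1 h2)
  rwa [← compl_sup, inf_compl_self] at this

theorem basic_sup (a b : A) : basic (a ⊔ b) = basic a ∪ basic b := by
  ext u
  exact u.mem_sup_iff a b

theorem notMem_of_disjoint (u : StoneSpace A) {a b : A} (h : Disjoint a b)
    (ha : a ∈ u.carrier) : b ∉ u.carrier := fun hb =>
  u.bot_notMem (h.eq_bot ▸ u.inf_mem ha hb)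

theorem isTopologicalBasis_basic :
    TopologicalSpace.IsTopologicalBasis (Set.range (basic : A → Set (StoneSpace A))) := by
  refine ⟨?_, ?_, rfl⟩
  · rintro _ ⟨a, rfl⟩ _ ⟨b, rfl⟩ x hx
    exact ⟨basic (a ⊓ b), ⟨_, rfl⟩, by rwa [basic_inf], by rw [basic_inf]⟩
  · exact Set.eq_univ_of_forall fun u => ⟨basic ⊤, ⟨⊤, rfl⟩, u.top_mem⟩

/-- Every nonzero element belongs to an ultrafilter. -/
theorem exists_mem {a : A} (ha : a ≠ ⊥) : ∃ u : StoneSpace A, a ∈ u.carrier := by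
  have hd : Disjoint ((Order.PFilter.principal a : Order.PFilter A) : Set A)
      (Order.Ideal.principal (⊥ : A) : Set A) := by
    rw [Set.disjoint_left]
    intro b hb hb'
    have h1 : a ≤ b := hb
    have h2 : b ≤ ⊥ := hb'
    exact ha (le_bot_iff.1 (h1.trans h2))
  obtain ⟨J, hJ, -, hJ2⟩ := DistribLattice.prime_ideal_of_disjoint_filter_ideal hd
  have haJ : a ∉ J := fun h => Set.disjoint_left.1 hJ2 (le_refl a : a ≤ a) h
  refine ⟨⟨{b | b ∉ J}, ?_, ?_, ?_, ?_, ?_⟩, haJ⟩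
  · exact fun h => haJ (J.lower le_top h)
  · exact fun h => h (Order.Ideal.bot_mem J)
  · exact fun h hab hb => h (J.lower hab hb)
  · intro b c hb hc h
    rcases hJ.mem_or_mem h with h | h
    exacts [hb h, hc h]
  · intro b
    by_contra! h
    have h1 : b ∈ J := not_not.1 h.1
    have h2 : bᶜ ∈ J := not_not.1 h.2
    exact haJ (J.lower le_top (sup_compl_eq_top (x := b) ▸ Order.Ideal.sup_mem h1 h2))

/-- Disjoint closed sets in a Stone space are separated by an element of the algebra. -/
theorem exists_separating {F G : Set (StoneSpace A)} (hF : IsClosed F) (hG : IsClosed G)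
    (hFG : Disjoint F G) : ∃ a : A, F ⊆ basic a ∧ Disjoint (basic a) G := by
  refine hF.isCompact.induction_on (p := fun S => ∃ a : A, S ⊆ basic a ∧ Disjoint (basic a) G)
    ⟨⊥, Set.empty_subset _, ?_⟩ ?_ ?_ ?_
  · exact Set.disjoint_left.2 fun u hu => (u.bot_notMem hu).elim
  · rintro s t hst ⟨a, ha, h⟩
    exact ⟨a, hst.trans ha, h⟩
  · rintro s t ⟨a, ha, ha'⟩ ⟨b, hb, hb'⟩
    refine ⟨a ⊔ b, ?_, ?_⟩
    · rw [basic_sup]; exact Set.union_subset_union ha hb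
    · rw [basic_sup]; exact Set.disjoint_union_left.2 ⟨ha', hb'⟩
  · intro x hx
    have hxG : x ∈ Gᶜ := fun h => Set.disjoint_left.1 hFG hx h
    obtain ⟨_, ⟨a, rfl⟩, hxa, haG⟩ :=
      isTopologicalBasis_basic.exists_subset_of_mem_open hxG hG.isOpen_compl
    exact ⟨basic a, mem_nhdsWithin_of_mem_nhds ((isOpen_basic a).mem_nhds hxa), a, le_rfl,
      Set.disjoint_left.2 fun u hu hu' => haG hu hu'⟩

/-- The indicator function of the clopen set `[a]`. -/
noncomputable def ind (a : A) : C(StoneSpace A, ℝ) where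
  toFun := (basic a).indicator fun _ => 1
  continuous_toFun := (continuous_const).indicator fun x hx => by
    rw [(isClopen_basic a).frontier_eq] at hx; exact hx.elim

theorem ind_of_mem {a : A} {u : StoneSpace A} (h : a ∈ u.carrier) : ind a u = 1 :=
  Set.indicator_of_mem (s := basic a) h fun _ => (1 : ℝ)

theorem ind_of_notMem {a : A} {u : StoneSpace A} (h : a ∉ u.carrier) : ind a u = 0 :=
  Set.indicator_of_notMem (s := basic a) h fun _ => (1 : ℝ)

theorem abs_ind_le (a : A) (u : StoneSpace A) : |ind a u| ≤ 1 := by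
  by_cases h : a ∈ u.carrier
  · simp [ind_of_mem h]
  · simp [ind_of_notMem h]

theorem norm_ind_le (a : A) : ‖ind a‖ ≤ 1 :=
  (ContinuousMap.norm_le _ zero_le_one).2 fun u => abs_ind_le a u

/-- The trace on a subalgebra `C` of an ultrafilter of `A`. -/
def res (C : BooleanSubalgebra A) (x : StoneSpace A) : StoneSpace C where
  carrier := {c | (c : A) ∈ x.carrier}
  top_mem := x.top_mem
  bot_notMem := x.bot_notMem
  mem_of_le := fun h hab => x.mem_of_le h hab
  inf_mem := fun h h' => x.inf_mem h h'
  mem_or_compl_mem := fun a => x.mem_or_compl_mem a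

theorem mem_res {C : BooleanSubalgebra A} {x : StoneSpace A} {c : C} :
    c ∈ (res C x).carrier ↔ (c : A) ∈ x.carrier := Iff.rfl

theorem continuous_res (C : BooleanSubalgebra A) : Continuous (res C) := by
  refine continuous_generateFrom_iff.2 ?_
  rintro _ ⟨c, rfl⟩
  exact isOpen_basic (c : A)

theorem exists_separating_res (C : BooleanSubalgebra A) {F G : Set (StoneSpace A)}
    (hF : IsClosed F) (hG : IsClosed G) (hFG : ∀ x ∈ F, ∀ y ∈ G, res C x ≠ res C y) :
    ∃ c ∈ C, F ⊆ basic c ∧ Disjoint (basic c) G := by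
  have hd : Disjoint (res C '' F) (res C '' G) := by
    rw [Set.disjoint_left]
    rintro _ ⟨x, hx, rfl⟩ ⟨y, hy, hxy⟩
    exact hFG x hx y hy hxy.symm
  obtain ⟨c, hc1, hc2⟩ := exists_separating
    (hF.isCompact.image (continuous_res C)).isClosed
    (hG.isCompact.image (continuous_res C)).isClosed hd
  refine ⟨c, c.2, fun x hx => hc1 ⟨x, hx, rfl⟩, Set.disjoint_left.2 fun x hx hx' => ?_⟩
  exact Set.disjoint_left.1 hc2 (show res C x ∈ basic c from hx) ⟨x, hx', rfl⟩

/-- An ultrafilter of `C` all of whose elements meet `a` extends to an ultrafilter of `A`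
containing `a`. -/
theorem exists_res_eq (C : BooleanSubalgebra A) (z : StoneSpace C) (a : A)
    (h : ∀ c ∈ z.carrier, (c : A) ⊓ a ≠ ⊥) : ∃ x : StoneSpace A, a ∈ x.carrier ∧ res C x = z := by
  have hne : (⋂ c : z.carrier, basic ((c : C) ⊓ a : A)).Nonempty := by
    have : Nonempty z.carrier := ⟨⟨⊤, z.top_mem⟩⟩
    refine IsCompact.nonempty_iInter_of_directed_nonempty_isCompact_isClosed _ ?_ ?_ ?_ ?_
    · rintro ⟨c, hc⟩ ⟨d, hd⟩
      refine ⟨⟨c ⊓ d, z.inf_mem hc hd⟩, fun x hx => ?_, fun x hx => ?_⟩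
      · exact x.mem_of_le hx (inf_le_inf_right _ inf_le_left)
      · exact x.mem_of_le hx (inf_le_inf_right _ inf_le_right)
    · exact fun c => exists_mem (h c c.2)
    · exact fun c => (isClopen_basic _).isClosed.isCompact
    · exact fun c => (isClopen_basic _).isClosed
  obtain ⟨x, hx⟩ := hne
  rw [Set.mem_iInter] at hx
  refine ⟨x, x.mem_of_le (hx ⟨⊤, z.top_mem⟩) inf_le_right, ?_⟩
  have hle : ∀ c ∈ z.carrier, (c : A) ∈ x.carrier := fun c hc =>
    x.mem_of_le (hx ⟨c, hc⟩) inf_le_left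
  ext c
  refine ⟨fun hc => ?_, fun hc => hle c hc⟩
  by_contra hcz
  exact (x.compl_mem_iff _).1 (hle cᶜ ((z.compl_mem_iff c).2 hcz)) hc

/-- An infinite set of points contains a sequence of points with pairwise disjoint basic
neighbourhoods. -/
theorem exists_disjoint_seq {Z : Set (StoneSpace A)} (hZ : Z.Infinite) :
    ∃ (z : ℕ → StoneSpace A) (c : ℕ → A), (∀ k, z k ∈ Z ∧ c k ∈ (z k).carrier) ∧
      Pairwise fun k l => Disjoint (c k) (c l) := by
  have step : ∀ d : {d : A // (Z ∩ basic d).Infinite}, ∃ (z : StoneSpace A) (c : A)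
      (d' : {d : A // (Z ∩ basic d).Infinite}), z ∈ Z ∧ c ∈ z.carrier ∧ c ≤ d ∧ d'.1 ≤ d.1 ∧
        Disjoint c d'.1 := by
    rintro ⟨d, hd⟩
    obtain ⟨u, hu, v, hv, huv⟩ := hd.nontrivial
    have key : ∀ u v : StoneSpace A, u ∈ Z ∩ basic d → v ∈ Z ∩ basic d → ∀ a, a ∈ u.carrier →
        a ∉ v.carrier → ∃ (z : StoneSpace A) (c : A)
      (d' : {d : A // (Z ∩ basic d).Infinite}), z ∈ Z ∧ c ∈ z.carrier ∧ c ≤ d ∧ d'.1 ≤ d ∧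
        Disjoint c d'.1 := by
      intro u v hu hv a ha ha'
      have ha'' := (v.compl_mem_iff a).2 ha'
      have hsplit : Z ∩ basic d = (Z ∩ basic (d ⊓ a)) ∪ (Z ∩ basic (d ⊓ aᶜ)) := by
        rw [basic_inf, basic_inf, basic_compl, ← Set.inter_union_distrib_left,
          ← Set.inter_union_distrib_left, Set.union_compl_self, Set.inter_univ]
      have hdis : Disjoint (d ⊓ a) (d ⊓ aᶜ) :=
        disjoint_compl_right.mono inf_le_right inf_le_right
      rw [hsplit, Set.infinite_union] at hd
      rcases hd with hd | hd
      · exact ⟨v, d ⊓ aᶜ, ⟨_, hd⟩, hv.1, v.inf_mem hv.2 ha'', inf_le_left, inf_le_left, hdis.symm⟩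
      · exact ⟨u, d ⊓ a, ⟨_, hd⟩, hu.1, u.inf_mem hu.2 ha, inf_le_left, inf_le_left, hdis⟩
    by_cases h : ∃ a, a ∈ u.carrier ∧ a ∉ v.carrier
    · obtain ⟨a, ha, ha'⟩ := h
      exact key u v hu hv a ha ha'
    · push Not at h
      have : ∃ a, a ∈ v.carrier ∧ a ∉ u.carrier := by
        by_contra! h'
        exact huv (StoneSpace.ext (Set.Subset.antisymm h h'))
      obtain ⟨a, ha, ha'⟩ := this
      exact key v u hv hu a ha ha'
  choose z c d' h1 h2 h3 h4 h5 using step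
  have h0 : (Z ∩ basic (⊤ : A)).Infinite := by
    convert hZ using 1
    exact Set.inter_eq_left.2 fun u _ => u.top_mem
  let D : ℕ → {d : A // (Z ∩ basic d).Infinite} := fun n => d'^[n] ⟨⊤, h0⟩
  have hD : ∀ n, D (n + 1) = d' (D n) := fun n => Function.iterate_succ_apply' _ _ _
  have hanti : Antitone fun n => (D n).1 := antitone_nat_of_succ_le fun n => by
    rw [hD]; exact h4 _
  refine ⟨fun n => z (D n), fun n => c (D n), fun k => ⟨h1 _, h2 _⟩, ?_⟩
  have hlt : ∀ k l, k < l → Disjoint (c (D k)) (c (D l)) := by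
    intro k l hkl
    refine (h5 (D k)).mono_right ((h3 (D l)).trans ?_)
    rw [← hD]
    exact hanti (Nat.succ_le_of_lt hkl)
  intro k l hkl
  rcases lt_or_gt_of_ne hkl with h | h
  · exact hlt k l h
  · exact (hlt l k h).symm

end StoneSpace

/-! ### The space `C(K_+)` as a space of sequences in `C(K)` -/

section Coordinates

variable {A : Type*} [BooleanAlgebra A]

open StoneSpace

/-- The copy in the `n`-th summand of `K_+` of a point of the Stone space of `A`. -/
def coordPt (C : BooleanSubalgebra A) (n : ℕ) (x : StoneSpace A) : Kplus C where
  carrier := {d | (d : ℕ → A) n ∈ x.carrier}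
  top_mem := x.top_mem
  bot_notMem := x.bot_notMem
  mem_of_le := fun h hab => x.mem_of_le h (hab n)
  inf_mem := fun h h' => x.inf_mem h h'
  mem_or_compl_mem := fun _ => x.mem_or_compl_mem _

theorem continuous_coordPt (C : BooleanSubalgebra A) (n : ℕ) : Continuous (coordPt C n) := by
  refine continuous_generateFrom_iff.2 ?_
  rintro _ ⟨d, rfl⟩
  exact isOpen_basic ((d : ℕ → A) n)

theorem exists_coordPt_mem {C : BooleanSubalgebra A} {d : Dplus C} {u : Kplus C}
    (h : d ∈ u.carrier) : ∃ n x, d ∈ (coordPt C n x).carrier := by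
  have hd : (d : ℕ → A) ≠ ⊥ := by
    intro h0
    have : d = ⊥ := Subtype.ext h0
    exact u.bot_notMem (this ▸ h)
  obtain ⟨n, hn⟩ := Function.ne_iff.1 hd
  obtain ⟨x, hx⟩ := exists_mem hn
  exact ⟨n, x, hx⟩

/-- The restriction of `f ∈ C(K_+)` to the `n`-th summand. -/
noncomputable def coord (C : BooleanSubalgebra A) (n : ℕ) : Xplus C →L[ℝ] C(StoneSpace A, ℝ) :=
  LinearMap.mkContinuous
    { toFun := fun f => f.comp ⟨coordPt C n, continuous_coordPt C n⟩
      map_add' := fun _ _ => rfl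
      map_smul' := fun _ _ => rfl } 1 fun f => by
    rw [one_mul]
    exact (ContinuousMap.norm_le _ (norm_nonneg f)).2 fun x => f.norm_coe_le_norm _

theorem coord_apply (C : BooleanSubalgebra A) (n : ℕ) (f : Xplus C) (x : StoneSpace A) :
    coord C n f x = f (coordPt C n x) := rfl

theorem norm_coord_apply_le (C : BooleanSubalgebra A) (n : ℕ) (f : Xplus C) :
    ‖coord C n f‖ ≤ ‖f‖ :=
  (ContinuousMap.norm_le _ (norm_nonneg f)).2 fun x => f.norm_coe_le_norm (coordPt C n x)

theorem abs_coord_apply_le (C : BooleanSubalgebra A) (n : ℕ) (f : Xplus C) (x : StoneSpace A) :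
    |coord C n f x| ≤ ‖f‖ := f.norm_coe_le_norm (coordPt C n x)

/-- The summands are dense in `K_+`, so the norm of `C(K_+)` is computed on them. -/
theorem norm_le_of_coord {C : BooleanSubalgebra A} {f : Xplus C} {r : ℝ} (hr : 0 ≤ r)
    (h : ∀ n, ‖coord C n f‖ ≤ r) : ‖f‖ ≤ r := by
  refine (ContinuousMap.norm_le _ hr).2 fun u => ?_
  by_contra! hu
  have hopen : IsOpen {v : Kplus C | r < ‖f v‖} := isOpen_lt continuous_const f.continuous.norm
  obtain ⟨_, ⟨d, rfl⟩, hud, hd⟩ := isTopologicalBasis_basic.exists_subset_of_mem_open hu hopen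
  obtain ⟨n, x, hx⟩ := exists_coordPt_mem hud
  have h1 : r < ‖f (coordPt C n x)‖ := hd hx
  exact absurd (((coord C n f).norm_coe_le_norm x).trans (h n)) (not_le.2 h1)

theorem ext_coord {C : BooleanSubalgebra A} {f g : Xplus C}
    (h : ∀ n, coord C n f = coord C n g) : f = g := by
  rw [← sub_eq_zero, ← norm_le_zero_iff]
  refine norm_le_of_coord le_rfl fun n => ?_
  rw [map_sub, h n, sub_self, norm_zero]

/-- A sequence of functions on the Stone space of `A` is asymptotically `C`-invariant if its
terms are asymptotically unable to tell apart ultrafilters with the same trace on `C`. -/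
def AsympInv (C : BooleanSubalgebra A) (g : ℕ → C(StoneSpace A, ℝ)) : Prop :=
  ∀ ε > 0, ∃ N, ∀ n ≥ N, ∀ x y, res C x = res C y → |g n x - g n y| ≤ ε

theorem AsympInv.add {C : BooleanSubalgebra A} {g h : ℕ → C(StoneSpace A, ℝ)}
    (hg : AsympInv C g) (hh : AsympInv C h) : AsympInv C fun n => g n + h n := by
  intro ε hε
  obtain ⟨N, hN⟩ := hg (ε / 2) (by positivity)
  obtain ⟨M, hM⟩ := hh (ε / 2) (by positivity)
  refine ⟨max N M, fun n hn x y hxy => ?_⟩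
  have h1 := hN n (le_of_max_le_left hn) x y hxy
  have h2 := hM n (le_of_max_le_right hn) x y hxy
  rw [ContinuousMap.add_apply, ContinuousMap.add_apply]
  calc |g n x + h n x - (g n y + h n y)| = |(g n x - g n y) + (h n x - h n y)| := by ring_nf
    _ ≤ _ := abs_add_le _ _
    _ ≤ ε := by linarith

theorem AsympInv.neg {C : BooleanSubalgebra A} {g : ℕ → C(StoneSpace A, ℝ)}
    (hg : AsympInv C g) : AsympInv C fun n => - g n := by
  intro ε hε
  obtain ⟨N, hN⟩ := hg ε hε
  refine ⟨N, fun n hn x y hxy => ?_⟩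
  have := hN n hn x y hxy
  rwa [ContinuousMap.neg_apply, ContinuousMap.neg_apply, neg_sub_neg, abs_sub_comm]

theorem asympInv_coord (C : BooleanSubalgebra A) (f : Xplus C) :
    AsympInv C fun n => coord C n f := by
  intro ε hε
  have key : ∃ N, ∀ n ≥ N, ∀ x y, res C x = res C y → coordPt C n x ∈ Set.univ →
      |coord C n f x - coord C n f y| ≤ ε := by
    refine (isCompact_univ (X := Kplus C)).induction_on (p := fun S => ∃ N, ∀ n ≥ N, ∀ x y,
      res C x = res C y → coordPt C n x ∈ S → |coord C n f x - coord C n f y| ≤ ε) ?_ ?_ ?_ ?_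
    · exact ⟨0, fun _ _ _ _ _ h => h.elim⟩
    · rintro s t hst ⟨N, hN⟩
      exact ⟨N, fun n hn x y hxy hx => hN n hn x y hxy (hst hx)⟩
    · rintro s t ⟨N, hN⟩ ⟨M, hM⟩
      refine ⟨max N M, fun n hn x y hxy hx => hx.elim (fun hx => ?_) fun hx => ?_⟩
      · exact hN n (le_of_max_le_left hn) x y hxy hx
      · exact hM n (le_of_max_le_right hn) x y hxy hx
    · intro u _
      have hopen : IsOpen {v : Kplus C | |f v - f u| < ε / 2} :=
        isOpen_lt (f.continuous.sub continuous_const).abs continuous_const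
      have hu : u ∈ {v : Kplus C | |f v - f u| < ε / 2} := by
        show |f u - f u| < ε / 2
        rw [sub_self, abs_zero]; positivity
      obtain ⟨_, ⟨d, rfl⟩, hud, hd⟩ := isTopologicalBasis_basic.exists_subset_of_mem_open hu hopen
      refine ⟨basic d, mem_nhdsWithin_of_mem_nhds ((isOpen_basic d).mem_nhds hud), ?_⟩
      obtain ⟨m, hm⟩ := d.2
      refine ⟨m + 1, fun n hn x y hxy hx => ?_⟩
      have hy : coordPt C n y ∈ basic d := by
        have h1 : (⟨(d : ℕ → A) n, hm n hn⟩ : C) ∈ (res C x).carrier := hx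
        rw [hxy] at h1
        exact h1
      have h1 : |f (coordPt C n x) - f u| < ε / 2 := hd hx
      have h2 : |f (coordPt C n y) - f u| < ε / 2 := hd hy
      rw [coord_apply, coord_apply, abs_le]
      rw [abs_lt] at h1 h2
      constructor <;> linarith
  obtain ⟨N, hN⟩ := key
  exact ⟨N, fun n hn x y hxy => hN n hn x y hxy trivial⟩

/-- One step of the extension procedure: a bounded asymptotically invariant sequence is
approximated, up to two thirds of its bound, by a multiple of an indicator function of `K_+`. -/
theorem exists_approx_coord {C : BooleanSubalgebra A} {g : ℕ → C(StoneSpace A, ℝ)} {r : ℝ}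
    (hr : 0 < r) (hg : AsympInv C g) (hgr : ∀ n x, |g n x| ≤ r) :
    ∃ f : Xplus C, ∀ n x, |g n x - coord C n f x| ≤ 2 / 3 * r := by
  obtain ⟨N, hN⟩ := hg (r / 3) (by positivity)
  have hF : ∀ n, IsClosed {x | r / 3 ≤ g n x} := fun n =>
    isClosed_le continuous_const (g n).continuous
  have hG : ∀ n, IsClosed {x | g n x ≤ - (r / 3)} := fun n =>
    isClosed_le (g n).continuous continuous_const
  have hsep : ∀ n, ∃ a : A, (N ≤ n → a ∈ C) ∧ {x | r / 3 ≤ g n x} ⊆ basic a ∧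
      Disjoint (basic a) {x | g n x ≤ - (r / 3)} := by
    intro n
    by_cases hn : N ≤ n
    · obtain ⟨c, hc, h1, h2⟩ := exists_separating_res C (hF n) (hG n) (fun x hx y hy hxy => by
        have h1 : r / 3 ≤ g n x := hx
        have h2 : g n y ≤ - (r / 3) := hy
        have := (abs_le.1 (hN n hn x y hxy)).2
        linarith)
      exact ⟨c, fun _ => hc, h1, h2⟩
    · obtain ⟨a, h1, h2⟩ := exists_separating (hF n) (hG n) (Set.disjoint_left.2 fun x hx hy => by
        have h1 : r / 3 ≤ g n x := hx
        have h2 : g n x ≤ - (r / 3) := hy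
        linarith)
      exact ⟨a, fun h => (hn h).elim, h1, h2⟩
  choose a ha h1 h2 using hsep
  let d : Dplus C := ⟨a, N, fun n hn => ha n hn.le⟩
  refine ⟨(2 * r / 3) • ind d - ContinuousMap.const _ (r / 3), fun n x => ?_⟩
  have hb := abs_le.1 (hgr n x)
  rw [coord_apply, ContinuousMap.sub_apply, ContinuousMap.smul_apply, ContinuousMap.const_apply,
    smul_eq_mul, abs_le]
  by_cases hx : d ∈ (coordPt C n x).carrier
  · have : ¬ g n x ≤ - (r / 3) := fun h => Set.disjoint_left.1 (h2 n) hx h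
    rw [ind_of_mem hx]
    constructor <;> linarith
  · have : ¬ r / 3 ≤ g n x := fun h => hx (h1 n h)
    rw [ind_of_notMem hx]
    constructor <;> linarith

/-- Every bounded asymptotically `C`-invariant sequence of functions is the sequence of
coordinates of an element of `C(K_+)`. -/
theorem exists_coord_eq {C : BooleanSubalgebra A} {g : ℕ → C(StoneSpace A, ℝ)} {r : ℝ}
    (hg : AsympInv C g) (hgr : ∀ n, ‖g n‖ ≤ r) : ∃ f : Xplus C, ∀ n, coord C n f = g n := by
  have hr : 0 ≤ r := (norm_nonneg _).trans (hgr 0)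
  have key : ∀ k : ℕ, ∃ f : Xplus C, ∀ n x, |g n x - coord C n f x| ≤ (2 / 3) ^ k * (r + 1) := by
    intro k
    induction k with
    | zero =>
      refine ⟨0, fun n x => ?_⟩
      rw [map_zero, ContinuousMap.zero_apply, sub_zero, pow_zero, one_mul]
      exact ((g n).norm_coe_le_norm x).trans ((hgr n).trans (by linarith))
    | succ k ih =>
      obtain ⟨f, hf⟩ := ih
      obtain ⟨f', hf'⟩ := exists_approx_coord (C := C) (g := fun n => g n + - coord C n f)
        (r := (2 / 3) ^ k * (r + 1)) (by positivity)
        (hg.add (asympInv_coord C f).neg) (fun n x => by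
          have := hf n x
          rwa [ContinuousMap.add_apply, ContinuousMap.neg_apply, ← sub_eq_add_neg])
      refine ⟨f + f', fun n x => ?_⟩
      have := hf' n x
      rw [ContinuousMap.add_apply, ContinuousMap.neg_apply] at this
      rw [map_add, ContinuousMap.add_apply]
      calc |g n x - (coord C n f x + coord C n f' x)|
          = |g n x + - coord C n f x - coord C n f' x| := by ring_nf
        _ ≤ _ := this
        _ = _ := by ring
  choose f hf using key
  have htend : Tendsto (fun k : ℕ => (2 / 3 : ℝ) ^ k * (r + 1)) atTop (𝓝 0) := by
    have := (tendsto_pow_atTop_nhds_zero_of_lt_one (r := (2 / 3 : ℝ)) (by norm_num)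
      (by norm_num)).mul_const (r + 1)
    rwa [zero_mul] at this
  have hcauchy : CauchySeq f := by
    refine cauchySeq_of_le_tendsto_0 (fun k => 2 * ((2 / 3 : ℝ) ^ k * (r + 1))) ?_ ?_
    · intro i j k hi hj
      rw [dist_eq_norm]
      refine norm_le_of_coord (by positivity) fun n => ?_
      refine (ContinuousMap.norm_le _ (by positivity)).2 fun x => ?_
      have h1 : (2 / 3 : ℝ) ^ i * (r + 1) ≤ (2 / 3) ^ k * (r + 1) :=
        mul_le_mul_of_nonneg_right (pow_le_pow_of_le_one (by norm_num) (by norm_num) hi)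
          (by linarith)
      have h2 : (2 / 3 : ℝ) ^ j * (r + 1) ≤ (2 / 3) ^ k * (r + 1) :=
        mul_le_mul_of_nonneg_right (pow_le_pow_of_le_one (by norm_num) (by norm_num) hj)
          (by linarith)
      have h3 := abs_le.1 (hf i n x)
      have h4 := abs_le.1 (hf j n x)
      rw [map_sub, ContinuousMap.sub_apply, Real.norm_eq_abs, abs_le]
      constructor <;> linarith [h3.1, h3.2, h4.1, h4.2]
    · simpa using htend.const_mul 2
  obtain ⟨F, hF⟩ := cauchySeq_tendsto_of_complete hcauchy
  refine ⟨F, fun n => ?_⟩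
  ext x
  have h1 : Tendsto (fun k => coord C n (f k) x) atTop (𝓝 (coord C n F x)) :=
    ((continuous_eval_const (coordPt C n x)).tendsto F).comp hF
  have h2 : Tendsto (fun k => coord C n (f k) x) atTop (𝓝 (g n x)) := by
    rw [tendsto_iff_dist_tendsto_zero]
    refine squeeze_zero (fun _ => dist_nonneg) (fun k => ?_) htend
    rw [dist_comm, Real.dist_eq]
    exact hf k n x
  exact tendsto_nhds_unique h1 h2

/-- A bounded linear operator into `C(K_+)` may be defined coordinatewise. -/
theorem exists_clm_coord {W : Type*} [NormedAddCommGroup W] [NormedSpace ℝ W]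
    (C : BooleanSubalgebra A) (G : ℕ → W →ₗ[ℝ] C(StoneSpace A, ℝ)) (r : ℝ)
    (hr : ∀ n w, ‖G n w‖ ≤ r * ‖w‖) (hG : ∀ w, AsympInv C fun n => G n w) :
    ∃ H : W →L[ℝ] Xplus C, (∀ w, ‖H w‖ ≤ r * ‖w‖) ∧ ∀ w n, coord C n (H w) = G n w := by
  have h : ∀ w, ∃ f : Xplus C, ∀ n, coord C n f = G n w := fun w =>
    exists_coord_eq (hG w) fun n => hr n w
  choose H hH using h
  have hb : ∀ w, ‖H w‖ ≤ r * ‖w‖ := fun w =>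
    norm_le_of_coord ((norm_nonneg _).trans (hr 0 w)) fun n => by rw [hH]; exact hr n w
  refine ⟨LinearMap.mkContinuous
    { toFun := H
      map_add' := fun v w => ext_coord fun n => by rw [map_add, hH, hH, hH, map_add]
      map_smul' := fun c w => ext_coord fun n => by
        rw [map_smul, hH, hH, RingHom.id_apply, map_smul] } r hb, hb, hH⟩

/-- Extension by zero from the `m`-th summand. -/
theorem exists_emb (C : BooleanSubalgebra A) (m : ℕ) :
    ∃ H : C(StoneSpace A, ℝ) →L[ℝ] Xplus C, (∀ g, ‖H g‖ ≤ ‖g‖) ∧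
      ∀ g n, coord C n (H g) = if n = m then g else 0 := by
  obtain ⟨H, h1, h2⟩ := exists_clm_coord C
    (fun n => if n = m then (LinearMap.id : C(StoneSpace A, ℝ) →ₗ[ℝ] _) else 0) 1
    (fun n w => by
      split_ifs
      · simp
      · simp)
    (fun w ε hε => ⟨m + 1, fun n hn x y _ => by
      have : n ≠ m := by omega
      simp [this, hε.le]⟩)
  refine ⟨H, fun g => by simpa using h1 g, fun g n => ?_⟩
  rw [h2]
  split_ifs <;> rfl

/-- The isometric embedding of `C(K)` in `C(K_+)` as the `m`-th summand. -/
noncomputable def emb (C : BooleanSubalgebra A) (m : ℕ) : C(StoneSpace A, ℝ) →L[ℝ] Xplus C :=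
  (exists_emb C m).choose

theorem norm_emb_le (C : BooleanSubalgebra A) (m : ℕ) (g : C(StoneSpace A, ℝ)) :
    ‖emb C m g‖ ≤ ‖g‖ := (exists_emb C m).choose_spec.1 g

theorem coord_emb (C : BooleanSubalgebra A) (n m : ℕ) (g : C(StoneSpace A, ℝ)) :
    coord C n (emb C m g) = if n = m then g else 0 := (exists_emb C m).choose_spec.2 g n

open Classical in
theorem exists_cut (C : BooleanSubalgebra A) (S : Set ℕ) :
    ∃ H : Xplus C →L[ℝ] Xplus C, (∀ g, ‖H g‖ ≤ ‖g‖) ∧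
      ∀ g n, coord C n (H g) = if n ∈ S then coord C n g else 0 := by
  obtain ⟨H, h1, h2⟩ := exists_clm_coord C
    (fun n => if n ∈ S then (coord C n : Xplus C →ₗ[ℝ] _) else 0) 1
    (fun n w => by
      split_ifs
      · simpa using norm_coord_apply_le C n w
      · simp)
    (fun w ε hε => by
      obtain ⟨N, hN⟩ := asympInv_coord C w ε hε
      refine ⟨N, fun n hn x y hxy => ?_⟩
      by_cases h : n ∈ S
      · simpa [h] using hN n hn x y hxy
      · simp [h, hε.le])
  refine ⟨H, fun g => by simpa using h1 g, fun g n => ?_⟩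
  rw [h2]
  split_ifs <;> rfl

/-- The restriction of a function on `K_+` to the summands with indices in `S`. -/
noncomputable def cut (C : BooleanSubalgebra A) (S : Set ℕ) : Xplus C →L[ℝ] Xplus C :=
  (exists_cut C S).choose

theorem norm_cut_le (C : BooleanSubalgebra A) (S : Set ℕ) (g : Xplus C) :
    ‖cut C S g‖ ≤ ‖g‖ := (exists_cut C S).choose_spec.1 g

open Classical in
theorem coord_cut (C : BooleanSubalgebra A) (S : Set ℕ) (g : Xplus C) (n : ℕ) :
    coord C n (cut C S g) = if n ∈ S then coord C n g else 0 := (exists_cut C S).choose_spec.2 g n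

end Coordinates

/-! ### Rosenthal's lemma -/

/-- Rosenthal's disjointification lemma. The elements of `T` are tests with supports in `ℕ`, and
`q k t` is the size of the `k`-th measure on the test `t`; the sizes are bounded and add up on
tests with disjoint supports. Then along some infinite set `N` no measure `q k` with `k ∈ N` is
larger than `ε` on the tests supported in `N \ {k}`. -/
theorem exists_infinite_forall_le {T : Type*} (supp : T → Set ℕ) (q : ℕ → T → ℝ) {r ε : ℝ}
    (hε : 0 < ε) (hqr : ∀ k t, q k t ≤ r)
    (hadd : ∀ k t₁ t₂, Disjoint (supp t₁) (supp t₂) →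
      ∃ t, supp t ⊆ supp t₁ ∪ supp t₂ ∧ q k t₁ + q k t₂ ≤ q k t)
    {N₀ : Set ℕ} (hN₀ : N₀.Infinite) :
    ∃ N ⊆ N₀, N.Infinite ∧ ∀ k ∈ N, ∀ t, supp t ⊆ N \ {k} → q k t ≤ ε := by
  have key : ∀ (j : ℕ) (N₀ : Set ℕ), N₀.Infinite →
      (∀ k ∈ N₀, ∀ t, supp t ⊆ N₀ → q k t ≤ j * ε) →
      ∃ N ⊆ N₀, N.Infinite ∧ ∀ k ∈ N, ∀ t, supp t ⊆ N \ {k} → q k t ≤ ε := by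
    intro j
    induction j with
    | zero =>
      intro N₀ hN₀ h
      refine ⟨N₀, le_rfl, hN₀, fun k hk t ht => ?_⟩
      have := h k hk t (ht.trans Set.sdiff_subset)
      rw [Nat.cast_zero, zero_mul] at this
      exact this.trans hε.le
    | succ j ih =>
      intro N₀ hN₀ h
      -- `N₀` is split into infinitely many infinite pieces `P p`.
      let e := hN₀.natEmbedding
      let P : ℕ → Set ℕ := fun p => Set.range fun i => (e (Nat.pair p i) : ℕ)
      have hPsub : ∀ p, P p ⊆ N₀ := by
        rintro p _ ⟨i, rfl⟩
        exact (e _).2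
      have hPinf : ∀ p, (P p).Infinite := fun p =>
        Set.infinite_range_of_injective fun i i' hi => by
          have := e.injective (Subtype.ext hi)
          exact (Nat.pair_eq_pair.1 this).2
      have hPdis : ∀ p p', p ≠ p' → Disjoint (P p) (P p') := by
        intro p p' hp
        rw [Set.disjoint_left]
        rintro _ ⟨i, rfl⟩ ⟨i', hi⟩
        have := e.injective (Subtype.ext hi)
        exact hp (Nat.pair_eq_pair.1 this).1.symm
      by_cases hgood : ∃ p, ∀ k ∈ P p, ∀ t, supp t ⊆ P p \ {k} → q k t ≤ ε
      · obtain ⟨p, hp⟩ := hgood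
        exact ⟨P p, hPsub p, hPinf p, hp⟩
      · -- Otherwise a transversal of the pieces loses `ε` of the mass.
        push Not at hgood
        choose k hk t ht hkt using hgood
        have hkinj : Function.Injective k := by
          intro p p' hpp
          by_contra hne
          exact Set.disjoint_left.1 (hPdis p p' hne) (hk p) (hpp ▸ hk p')
        have hsub : Set.range k ⊆ N₀ := by
          rintro _ ⟨p, rfl⟩
          exact hPsub p (hk p)
        obtain ⟨N, hN, hN2⟩ := ih (Set.range k) (Set.infinite_range_of_injective hkinj) (by
          rintro _ ⟨p, rfl⟩ t' ht'
          have hdis : Disjoint (supp t') (supp (t p)) := by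
            rw [Set.disjoint_left]
            intro l hl hl'
            obtain ⟨p', rfl⟩ := ht' hl
            have h1 := ht p hl'
            have : p' = p := by
              by_contra hne
              exact Set.disjoint_left.1 (hPdis p' p hne) (hk p') h1.1
            subst this
            exact h1.2 rfl
          obtain ⟨t'', h1, h2⟩ := hadd (k p) t' (t p) hdis
          have h3 := h (k p) (hsub ⟨p, rfl⟩) t'' (h1.trans (Set.union_subset (ht'.trans hsub)
            (((ht p).trans Set.sdiff_subset).trans (hPsub p))))
          have h4 := hkt p
          push_cast at h3
          linarith)
        exact ⟨N, hN.trans hsub, hN2⟩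
  obtain ⟨j, hj⟩ := exists_nat_ge (r / ε)
  refine key j N₀ hN₀ fun k _ t _ => (hqr k t).trans ?_
  rwa [div_le_iff₀ hε] at hj

/-- Rosenthal's lemma for the rows of a matrix, which are bounded in `ℓ_1`. -/
theorem exists_infinite_sum_abs_le (a : ℕ → ℕ → ℝ) {r ε : ℝ} (hε : 0 < ε)
    (ha : ∀ k (F : Finset ℕ), ∑ l ∈ F, |a k l| ≤ r) {N₀ : Set ℕ} (hN₀ : N₀.Infinite) :
    ∃ N ⊆ N₀, N.Infinite ∧ ∀ k ∈ N, ∀ F : Finset ℕ, (F : Set ℕ) ⊆ N \ {k} →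
      ∑ l ∈ F, |a k l| ≤ ε := by
  classical
  refine exists_infinite_forall_le (fun F : Finset ℕ => (F : Set ℕ)) (fun k F => ∑ l ∈ F, |a k l|)
    hε ha ?_ hN₀
  intro k F G hFG
  refine ⟨F ∪ G, by rw [Finset.coe_union], ?_⟩
  rw [Finset.sum_union (Finset.disjoint_coe.1 hFG)]

/-! ### Operators on `ℓ_∞` -/

theorem exists_sign (v : ℝ) : ∃ σ : ℝ, |σ| ≤ 1 ∧ σ * v = |v| := by
  rcases le_total 0 v with h | h
  · exact ⟨1, by simp, by rw [abs_of_nonneg h, one_mul]⟩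
  · exact ⟨-1, by simp, by rw [abs_of_nonpos h]; ring⟩

/-- The space of bounded real sequences. -/
abbrev Linf : Type := lp (fun _ : ℕ => ℝ) ⊤

/-- The bounded sequence with given terms. -/
def Linf.mk (a : ℕ → ℝ) {r : ℝ} (h : ∀ n, |a n| ≤ r) : Linf :=
  ⟨a, memℓp_infty ⟨r, by rintro _ ⟨n, rfl⟩; exact h n⟩⟩

theorem Linf.add_apply (a b : Linf) (n : ℕ) : (a + b) n = a n + b n := rfl

theorem Linf.sub_apply (a b : Linf) (n : ℕ) : (a - b) n = a n - b n := rfl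

theorem Linf.smul_apply (c : ℝ) (a : Linf) (n : ℕ) : (c • a) n = c * a n := rfl

theorem Linf.zero_apply (n : ℕ) : (0 : Linf) n = 0 := rfl

theorem Linf.abs_le (a : Linf) (n : ℕ) : |a n| ≤ ‖a‖ := lp.norm_apply_le_norm (by simp) a n

theorem Linf.norm_le {a : Linf} {r : ℝ} (hr : 0 ≤ r) (h : ∀ n, |a n| ≤ r) : ‖a‖ ≤ r :=
  lp.norm_le_of_forall_le hr h

/-- The `k`-th unit vector. -/
noncomputable def Linf.unit (k : ℕ) : Linf :=
  Linf.mk (fun n => if n = k then 1 else 0) (r := 1) fun n => by split_ifs <;> simp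

theorem Linf.unit_apply (k n : ℕ) : Linf.unit k n = if n = k then 1 else 0 := rfl

/-- Rosenthal's lemma for functionals on `ℓ_∞`, that is, for finitely additive signed measures
on `ℕ`. -/
theorem exists_infinite_functional_le (ψ : ℕ → Linf →L[ℝ] ℝ) {r ε : ℝ} (hε : 0 < ε)
    (hψ : ∀ k, ‖ψ k‖ ≤ r) {N₀ : Set ℕ} (hN₀ : N₀.Infinite) :
    ∃ N ⊆ N₀, N.Infinite ∧ ∀ k ∈ N, ∀ t : Linf, ‖t‖ ≤ 1 → (∀ l, l ∉ N \ {k} → t l = 0) →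
      |ψ k t| ≤ ε := by
  obtain ⟨N, h1, h2, h3⟩ := exists_infinite_forall_le
    (T := {t : Linf // ‖t‖ ≤ 1}) (fun t => {l | t.1 l ≠ 0}) (fun k t => |ψ k t.1|)
    hε
    (fun k t => ((ψ k).le_of_opNorm_le (hψ k) t.1).trans
      (mul_le_of_le_one_right ((norm_nonneg _).trans (hψ k)) t.2)) (by
    rintro k ⟨t₁, ht₁⟩ ⟨t₂, ht₂⟩ hd
    have hcomb : ∀ σ τ : ℝ, |σ| ≤ 1 → |τ| ≤ 1 → ‖σ • t₁ + τ • t₂‖ ≤ 1 := by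
      intro σ τ hσ hτ
      refine Linf.norm_le zero_le_one fun n => ?_
      rw [Linf.add_apply, Linf.smul_apply, Linf.smul_apply]
      by_cases h : t₁ n = 0
      · rw [h, mul_zero, zero_add, abs_mul]
        exact mul_le_one₀ hτ (abs_nonneg _) ((Linf.abs_le _ _).trans ht₂)
      · have : t₂ n = 0 := by
          by_contra h'
          exact Set.disjoint_left.1 hd h h'
        rw [this, mul_zero, add_zero, abs_mul]
        exact mul_le_one₀ hσ (abs_nonneg _) ((Linf.abs_le _ _).trans ht₁)
    obtain ⟨σ, hσ, hσ'⟩ := exists_sign (ψ k t₁)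
    obtain ⟨τ, hτ, hτ'⟩ := exists_sign (ψ k t₂)
    refine ⟨⟨σ • t₁ + τ • t₂, hcomb σ τ hσ hτ⟩, ?_, ?_⟩
    · intro n hn
      by_contra hc
      rw [Set.mem_union, not_or] at hc
      have h1 : t₁ n = 0 := not_not.1 hc.1
      have h2 : t₂ n = 0 := not_not.1 hc.2
      apply hn
      show (σ • t₁ + τ • t₂) n = 0
      rw [Linf.add_apply, Linf.smul_apply, Linf.smul_apply, h1, h2, mul_zero, mul_zero, add_zero]
    · rw [map_add, map_smul, map_smul, smul_eq_mul, smul_eq_mul, hσ', hτ']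
      exact le_abs_self _) hN₀
  refine ⟨N, h1, h2, fun k hk t ht hs => h3 k hk ⟨t, ht⟩ fun l hl => ?_⟩
  by_contra hc
  exact hl (hs l hc)

theorem exists_enum {N : Set ℕ} (hN : N.Infinite) :
    ∃ e : ℕ → ℕ, Function.Injective e ∧ Set.range e = N := by
  classical
  have := hN.to_subtype
  exact ⟨Nat.orderEmbeddingOfSet N, (Nat.orderEmbeddingOfSet N).injective,
    Nat.orderEmbeddingOfSet_range N⟩

/-- The isometric embedding of `ℓ_∞` in itself that moves the coordinates along an injection. -/
theorem exists_linf_extend {e : ℕ → ℕ} (he : Function.Injective e) :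
    ∃ J : Linf →L[ℝ] Linf, (∀ a, ‖J a‖ ≤ ‖a‖) ∧ (∀ a i, J a (e i) = a i) ∧
      ∀ a n, n ∉ Set.range e → J a n = 0 := by
  have hval : ∀ (a : Linf) (n : ℕ), |Function.extend e a 0 n| ≤ ‖a‖ := by
    intro a n
    by_cases h : ∃ i, e i = n
    · obtain ⟨i, rfl⟩ := h
      rw [he.extend_apply]; exact Linf.abs_le a i
    · rw [Function.extend_apply' _ _ _ h]; simp
  refine ⟨LinearMap.mkContinuous
    { toFun := fun a => Linf.mk (Function.extend e a 0) (hval a)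
      map_add' := fun a b => ?_
      map_smul' := fun c a => ?_ } 1 fun a => ?_, fun a => ?_, fun a i => ?_, fun a n h => ?_⟩
  · refine lp.ext (funext fun n => ?_)
    show Function.extend e (a + b : Linf) 0 n = Function.extend e a 0 n + Function.extend e b 0 n
    by_cases h : ∃ i, e i = n
    · obtain ⟨i, rfl⟩ := h
      rw [he.extend_apply, he.extend_apply, he.extend_apply, Linf.add_apply]
    · rw [Function.extend_apply' _ _ _ h, Function.extend_apply' _ _ _ h,
        Function.extend_apply' _ _ _ h, Pi.zero_apply, add_zero]
  · refine lp.ext (funext fun n => ?_)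
    show Function.extend e (c • a : Linf) 0 n = c * Function.extend e a 0 n
    by_cases h : ∃ i, e i = n
    · obtain ⟨i, rfl⟩ := h
      rw [he.extend_apply, he.extend_apply, Linf.smul_apply]
    · simp [Function.extend_apply' _ _ _ h]
  · rw [one_mul]; exact Linf.norm_le (norm_nonneg _) (hval a)
  · exact Linf.norm_le (norm_nonneg _) (hval a)
  · exact he.extend_apply _ _ _
  · exact Function.extend_apply' _ _ _ h

/-- If `C(Y)` has no isomorphic copy of `ℓ_∞`, then every bounded operator from `ℓ_∞` to `C(Y)`
sends the unit vectors to a null sequence. -/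
theorem finite_setOf_lt_norm_unit {Y : Type*} [TopologicalSpace Y] [CompactSpace Y]
    (hY : ¬ ContainsLinfty C(Y, ℝ)) (R : Linf →L[ℝ] C(Y, ℝ)) {ε : ℝ} (hε : 0 < ε) :
    {k | ∃ y, ε < |R (Linf.unit k) y|}.Finite := by
  by_contra hinf
  have hinf : {k | ∃ y, ε < |R (Linf.unit k) y|}.Infinite := hinf
  have hY' : Nonempty Y := by
    obtain ⟨k, y, -⟩ := hinf.nonempty
    exact ⟨y⟩
  have hy : ∀ k, ∃ y, (∃ y, ε < |R (Linf.unit k) y|) → ε < |R (Linf.unit k) y| := by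
    intro k
    by_cases h : ∃ y, ε < |R (Linf.unit k) y|
    · obtain ⟨y, hy⟩ := h
      exact ⟨y, fun _ => hy⟩
    · exact ⟨hY'.some, fun h' => (h h').elim⟩
  choose y hy using hy
  let ψ : ℕ → Linf →L[ℝ] ℝ := fun k => (ContinuousMap.evalCLM ℝ (y k)).comp R
  have hψ : ∀ k, ‖ψ k‖ ≤ ‖R‖ := fun k =>
    ContinuousLinearMap.opNorm_le_bound _ (norm_nonneg R) fun t =>
      ((R t).norm_coe_le_norm (y k)).trans (R.le_opNorm t)
  obtain ⟨N, hN, hNinf, hN2⟩ := exists_infinite_functional_le ψ (half_pos hε) hψ hinf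
  obtain ⟨e, he, heN⟩ := exists_enum hNinf
  obtain ⟨J, hJ1, hJ2, hJ3⟩ := exists_linf_extend he
  rw [heN] at hJ3
  refine hY ⟨R.comp J, ?_⟩
  refine (ContinuousLinearMap.antilipschitz_of_bound (K := ⟨2 / ε, by positivity⟩) _
    fun a => ?_).isEmbedding (R.comp J).continuous
  show ‖a‖ ≤ 2 / ε * ‖R (J a)‖
  have hcoef : ∀ i, ε * |a i| ≤ ‖R (J a)‖ + ε / 2 * ‖a‖ := by
    intro i
    -- The part of `J a` off the coordinate `e i` contributes at most `ε / 2 * ‖a‖` at `y (e i)`.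
    set t : Linf := J a - a i • Linf.unit (e i) with ht
    have htn : ‖t‖ ≤ ‖a‖ := by
      refine Linf.norm_le (norm_nonneg _) fun n => ?_
      rw [ht, Linf.sub_apply, Linf.smul_apply, Linf.unit_apply]
      split_ifs with h
      · rw [h, hJ2]; simp
      · rw [mul_zero, sub_zero]
        exact (Linf.abs_le _ _).trans (hJ1 a)
    have hts : ∀ l, l ∉ N \ {e i} → t l = 0 := by
      intro l hl
      rw [ht, Linf.sub_apply, Linf.smul_apply, Linf.unit_apply]
      split_ifs with h
      · rw [h, hJ2]; simp
      · rw [hJ3 a l fun hlN => hl ⟨hlN, h⟩]; simp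
    have heN' : e i ∈ N := heN ▸ Set.mem_range_self i
    have h1 : |ψ (e i) t| ≤ ε / 2 * ‖a‖ := by
      rcases eq_or_lt_of_le (norm_nonneg a) with h0 | h0
      · have : t = 0 := norm_le_zero_iff.1 (htn.trans h0.symm.le)
        rw [this, map_zero, abs_zero, ← h0, mul_zero]
      · have := hN2 (e i) heN' (‖a‖⁻¹ • t) (by
          rw [norm_smul, norm_inv, norm_norm, inv_mul_le_iff₀ h0, mul_one]; exact htn)
          (fun l hl => by rw [Linf.smul_apply, hts l hl, mul_zero])
        rw [map_smul, smul_eq_mul, abs_mul, abs_inv, abs_norm, inv_mul_le_iff₀ h0] at this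
        linarith
    have h2 : |ψ (e i) (J a)| ≤ ‖R (J a)‖ := (R (J a)).norm_coe_le_norm _
    have h3 : ψ (e i) (J a) = ψ (e i) t + a i * ψ (e i) (Linf.unit (e i)) := by
      rw [ht, map_sub, map_smul, smul_eq_mul, sub_add_cancel]
    have h4 : ε < |ψ (e i) (Linf.unit (e i))| := hy (e i) (hN heN')
    have h5 : |a i * ψ (e i) (Linf.unit (e i))| ≤ |ψ (e i) (J a)| + |ψ (e i) t| := by
      have : a i * ψ (e i) (Linf.unit (e i)) = ψ (e i) (J a) - ψ (e i) t := by rw [h3]; ring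
      rw [this]; exact abs_sub _ _
    rw [abs_mul] at h5
    nlinarith [abs_nonneg (a i)]
  have h1 : ‖a‖ ≤ (‖R (J a)‖ + ε / 2 * ‖a‖) / ε := by
    refine Linf.norm_le (by positivity) fun i => ?_
    rw [le_div_iff₀ hε, mul_comm]
    exact hcoef i
  rw [le_div_iff₀ hε] at h1
  rw [div_mul_eq_mul_div, le_div_iff₀ hε]
  linarith

/-! ### Weakly compact operators and disjoint functions -/

theorem abs_sum_le_of_disjoint {ι : Type*} (F : Finset ι) (a : ι → ℝ) (v : ι → ℝ) {r : ℝ}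
    (hr : 0 ≤ r) (ha : ∀ k ∈ F, |a k| ≤ r) (hv : ∀ k ∈ F, |v k| ≤ 1)
    (hd : ∀ k ∈ F, ∀ l ∈ F, k ≠ l → v k = 0 ∨ v l = 0) : |∑ k ∈ F, a k * v k| ≤ r := by
  by_cases h : ∃ k ∈ F, v k ≠ 0
  · obtain ⟨k, hk, hvk⟩ := h
    rw [Finset.sum_eq_single_of_mem k hk fun l hl hlk => by
      rw [(hd l hl k hk hlk).resolve_right hvk, mul_zero], abs_mul]
    exact (mul_le_of_le_one_right (abs_nonneg _) (hv k hk)).trans (ha k hk)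
  · push Not at h
    rwa [Finset.sum_eq_zero fun k hk => by rw [h k hk, mul_zero], abs_zero]

theorem norm_sum_le_of_disjoint {ι X : Type*} [TopologicalSpace X] [CompactSpace X]
    (F : Finset ι) (a : ι → ℝ) (f : ι → C(X, ℝ)) {r : ℝ} (hr : 0 ≤ r) (ha : ∀ k ∈ F, |a k| ≤ r)
    (hf : ∀ k ∈ F, ‖f k‖ ≤ 1) (hd : ∀ k ∈ F, ∀ l ∈ F, k ≠ l → ∀ x, f k x = 0 ∨ f l x = 0) :
    ‖∑ k ∈ F, a k • f k‖ ≤ r := by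
  refine (ContinuousMap.norm_le _ hr).2 fun x => ?_
  rw [ContinuousMap.sum_apply]
  exact abs_sum_le_of_disjoint F a (fun k => f k x) hr ha
    (fun k hk => ((f k).norm_coe_le_norm x).trans (hf k hk)) fun k hk l hl hkl => hd k hk l hl hkl x

theorem sum_abs_le_of_disjoint {ι X : Type*} [TopologicalSpace X] [CompactSpace X]
    (ψ : C(X, ℝ) →L[ℝ] ℝ) (F : Finset ι) (f : ι → C(X, ℝ))
    (hf : ∀ k ∈ F, ‖f k‖ ≤ 1) (hd : ∀ k ∈ F, ∀ l ∈ F, k ≠ l → ∀ x, f k x = 0 ∨ f l x = 0) :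
    ∑ k ∈ F, |ψ (f k)| ≤ ‖ψ‖ := by
  choose σ hσ hσ' using fun k => exists_sign (ψ (f k))
  calc ∑ k ∈ F, |ψ (f k)| = ψ (∑ k ∈ F, σ k • f k) := by
        rw [map_sum]
        exact Finset.sum_congr rfl fun k _ => by rw [map_smul, smul_eq_mul, hσ']
    _ ≤ ‖ψ (∑ k ∈ F, σ k • f k)‖ := le_abs_self _
    _ ≤ ‖ψ‖ := (ψ.le_opNorm _).trans (mul_le_of_le_one_right (norm_nonneg _)
        (norm_sum_le_of_disjoint F σ f zero_le_one (fun k _ => hσ k) hf hd))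

/-- A weakly compact operator on `C(X)` is small on some term of each bounded sequence of
disjointly supported functions. Otherwise Rosenthal's lemma yields signed functions `g i` and
points `y i` such that the partial sums `u n` of `S (g i)` are large at `y i` for `i < n` and small
at `y i` for `n ≤ i`; a weak cluster point of the `u n` would have to be both large and small at
a cluster point of the `y i`. -/
theorem IsWeaklyCompactOperator.exists_norm_le {X Y : Type*} [TopologicalSpace X] [CompactSpace X]
    [TopologicalSpace Y] [CompactSpace Y] {S : C(X, ℝ) →L[ℝ] C(Y, ℝ)}
    (hS : IsWeaklyCompactOperator S) (f : ℕ → C(X, ℝ)) (hf : ∀ k, ‖f k‖ ≤ 1)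
    (hd : ∀ k l, k ≠ l → ∀ x, f k x = 0 ∨ f l x = 0) {ε : ℝ} (hε : 0 < ε) :
    ∃ k, ‖S (f k)‖ ≤ ε := by
  by_contra! hcon
  have hy : ∀ k, ∃ y, ε < |S (f k) y| := by
    intro k
    by_contra! h
    exact absurd ((ContinuousMap.norm_le _ hε.le).2 h) (not_le.2 (hcon k))
  choose y hy using hy
  choose σ hσ hσ' using fun k => exists_sign (S (f k) (y k))
  have hrow : ∀ k (F : Finset ℕ), ∑ l ∈ F, |S (f l) (y k)| ≤ ‖S‖ := by
    intro k F
    refine (sum_abs_le_of_disjoint ((ContinuousMap.evalCLM ℝ (y k)).comp S) F f (fun k _ => hf k)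
      fun k _ l _ => hd k l).trans ?_
    exact ContinuousLinearMap.opNorm_le_bound _ (norm_nonneg S) fun t =>
      ((S t).norm_coe_le_norm (y k)).trans (S.le_opNorm t)
  obtain ⟨N, -, hNinf, hN⟩ := exists_infinite_sum_abs_le (fun k l => S (f l) (y k))
    (ε := ε / 4) (by positivity) hrow Set.infinite_univ
  obtain ⟨e, he, heN⟩ := exists_enum hNinf
  have hoff : ∀ i (F : Finset ℕ), i ∉ F → |∑ j ∈ F, σ (e j) * S (f (e j)) (y (e i))| ≤ ε / 4 := by
    intro i F hi
    have h1 := hN (e i) (heN ▸ Set.mem_range_self i) (F.map ⟨e, he⟩) (by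
      intro l hl
      obtain ⟨j, hj, rfl⟩ := Finset.mem_map.1 (Finset.mem_coe.1 hl)
      refine ⟨heN ▸ Set.mem_range_self j, fun h => hi ?_⟩
      rw [← he h]; exact hj)
    rw [Finset.sum_map] at h1
    refine (Finset.abs_sum_le_sum_abs _ _).trans ((Finset.sum_le_sum fun j _ => ?_).trans h1)
    rw [abs_mul]
    exact mul_le_of_le_one_left (abs_nonneg _) (hσ _)
  let u : ℕ → C(Y, ℝ) := fun n => S (∑ j ∈ Finset.range n, σ (e j) • f (e j))
  have hu : ∀ n x, u n x = ∑ j ∈ Finset.range n, σ (e j) * S (f (e j)) x := by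
    intro n x
    simp only [u, map_sum, map_smul, ContinuousMap.sum_apply, ContinuousMap.smul_apply,
      smul_eq_mul]
  have hlow : ∀ i n, i < n → 3 * ε / 4 ≤ u n (y (e i)) := by
    intro i n hin
    rw [hu, ← Finset.add_sum_erase _ _ (Finset.mem_range.2 hin), hσ']
    have h1 := hoff i ((Finset.range n).erase i) (Finset.notMem_erase _ _)
    have h2 := hy (e i)
    have h3 := (abs_le.1 h1).1
    linarith
  have hup : ∀ i n, n ≤ i → u n (y (e i)) ≤ ε / 4 := by
    intro i n hin
    rw [hu]
    exact (abs_le.1 (hoff i (Finset.range n) (by simpa using hin))).2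
  have hmem : ∀ n, toWeakSpace ℝ C(Y, ℝ) (u n) ∈
      closure (toWeakSpace ℝ C(Y, ℝ) '' (S '' Metric.closedBall (0 : C(X, ℝ)) 1)) := by
    intro n
    refine subset_closure ⟨_, ⟨_, ?_, rfl⟩, rfl⟩
    rw [mem_closedBall_zero_iff]
    exact norm_sum_le_of_disjoint _ _ (fun j => f (e j)) zero_le_one (fun j _ => hσ _) (fun j _ => hf _)
      fun j _ l _ hjl => hd _ _ fun h => hjl (he h)
  obtain ⟨w, -, hw⟩ := IsCompact.exists_mapClusterPt hS (f := atTop)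
    (u := fun n => toWeakSpace ℝ C(Y, ℝ) (u n)) (tendsto_principal.2 (Eventually.of_forall hmem))
  let w' : C(Y, ℝ) := (toWeakSpace ℝ C(Y, ℝ)).symm w
  have hcl : ∀ x, MapClusterPt (w' x) atTop fun n => u n x := by
    intro x
    have hc : Continuous fun v : WeakSpace ℝ C(Y, ℝ) => (toWeakSpace ℝ C(Y, ℝ)).symm v x :=
      WeakBilin.eval_continuous (topDualPairing ℝ C(Y, ℝ)).flip (ContinuousMap.evalCLM ℝ x)
    exact hw.continuousAt_comp hc.continuousAt
  have hge : ∀ i, 3 * ε / 4 ≤ w' (y (e i)) := by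
    intro i
    by_contra! h
    obtain ⟨n, hn, hin⟩ := (((hcl (y (e i))).frequently (eventually_lt_nhds h)).and_eventually
      (eventually_gt_atTop i)).exists
    exact absurd (hlow i n hin) (not_le.2 hn)
  obtain ⟨y', -, hy'⟩ := isCompact_univ.exists_mapClusterPt (f := atTop)
    (u := fun i => y (e i)) (by simp)
  have h1 : 3 * ε / 4 ≤ w' y' := by
    by_contra! h
    obtain ⟨i, hi⟩ := (hy'.frequently
      (w'.continuous.continuousAt.eventually (eventually_lt_nhds h))).exists
    exact absurd (hge i) (not_le.2 hi)
  have h2 : ∀ n, u n y' ≤ ε / 4 := by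
    intro n
    by_contra! h
    obtain ⟨i, hi, hin⟩ := ((hy'.frequently
      ((u n).continuous.continuousAt.eventually (eventually_gt_nhds h))).and_eventually
      (eventually_ge_atTop n)).exists
    exact absurd (hup i n hin) (not_le.2 hi)
  have h3 : ε / 4 < w' y' := by linarith
  obtain ⟨n, hn⟩ := ((hcl y').frequently (eventually_gt_nhds h3)).exists
  exact absurd (h2 n) (not_le.2 hn)

/-! ### Suprema of subsequences -/

section Suprema

variable {A : Type*} [BooleanAlgebra A]

open StoneSpace

namespace StoneSpace

theorem ind_sup {a b : A} (h : Disjoint a b) : ind (a ⊔ b) = ind a + ind b := by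
  ext u
  rw [ContinuousMap.add_apply]
  by_cases ha : a ∈ u.carrier
  · rw [ind_of_mem ha, ind_of_notMem (u.notMem_of_disjoint h ha),
      ind_of_mem ((u.mem_sup_iff a b).2 (Or.inl ha)), add_zero]
  · by_cases hb : b ∈ u.carrier
    · rw [ind_of_notMem ha, ind_of_mem hb, ind_of_mem ((u.mem_sup_iff a b).2 (Or.inr hb)), zero_add]
    · rw [ind_of_notMem ha, ind_of_notMem hb,
        ind_of_notMem fun h => ((u.mem_sup_iff a b).1 h).elim ha hb, add_zero]

theorem ind_finset_sup {ι : Type*} (F : Finset ι) (c : ι → A)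
    (hc : ∀ k ∈ F, ∀ l ∈ F, k ≠ l → Disjoint (c k) (c l)) :
    ind (F.sup c) = ∑ k ∈ F, ind (c k) := by
  classical
  induction F using Finset.induction_on with
  | empty =>
    ext u
    rw [Finset.sup_empty, ind_of_notMem u.bot_notMem, Finset.sum_empty, ContinuousMap.zero_apply]
  | insert k F hk ih =>
    rw [Finset.sup_insert, ind_sup, Finset.sum_insert hk, ih]
    · exact fun i hi j hj => hc i (Finset.mem_insert_of_mem hi) j (Finset.mem_insert_of_mem hj)
    · refine Finset.disjoint_sup_right.2 fun l hl => ?_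
      refine hc k (Finset.mem_insert_self _ _) l (Finset.mem_insert_of_mem hl) ?_
      rintro rfl; exact hk hl

theorem ind_disjoint {a b : A} (h : Disjoint a b) (u : StoneSpace A) :
    ind a u = 0 ∨ ind b u = 0 := by
  by_cases ha : a ∈ u.carrier
  · exact Or.inr (ind_of_notMem (u.notMem_of_disjoint h ha))
  · exact Or.inl (ind_of_notMem ha)

end StoneSpace

/-- The branch of the binary tree determined by `b`, with the nodes coded by natural numbers. -/
def branch (b : ℕ → Bool) (n : ℕ) : ℕ := Encodable.encode ((List.range n).map b)

theorem branch_eq {b b' : ℕ → Bool} {n n' : ℕ} (h : branch b n = branch b' n') :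
    n = n' ∧ ∀ i < n, b i = b' i := by
  have h1 : (List.range n).map b = (List.range n').map b' := Encodable.encode_injective h
  have h2 : n = n' := by simpa using congrArg List.length h1
  subst h2
  refine ⟨rfl, fun i hi => ?_⟩
  exact (List.map_inj_left.1 h1) i (List.mem_range.2 hi)

theorem branch_injective (b : ℕ → Bool) : Function.Injective (branch b) :=
  fun _ _ h => (branch_eq h).1

/-- Different branches have only finitely many nodes in common. -/
theorem exists_bound_branch {b b' : ℕ → Bool} (h : b ≠ b') :
    ∃ p, ∀ n n', branch b n = branch b' n' → branch b n < p := by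
  obtain ⟨i, hi⟩ := Function.ne_iff.1 h
  have hfin : ((branch b) '' {n | n ≤ i}).Finite := (Set.finite_le_nat i).image _
  obtain ⟨p, hp⟩ := hfin.bddAbove
  refine ⟨p + 1, fun n n' hn => Nat.lt_succ_of_le (hp ⟨n, ?_, rfl⟩)⟩
  by_contra hc
  exact hi ((branch_eq hn).2 i (not_le.1 hc))

theorem not_countable_bool_seq : ¬ (Set.univ : Set (ℕ → Bool)).Countable := by
  intro h
  classical
  have := Set.countable_univ_iff.1 h
  obtain ⟨f, hf⟩ := exists_injective_nat (ℕ → Bool)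
  refine Function.cantor_injective (fun S : Set ℕ => f fun n => decide (n ∈ S)) fun S S' hS => ?_
  ext n
  have := congrFun (hf hS) n
  simpa using this

/-- Let `s` and `s'` be the suprema of the subfamilies of a disjoint family with indices in `M` and
`M'`. After finitely many terms, including all the common ones, have been removed from both, `s`
and `s'` are disjoint. -/
theorem disjoint_sdiff_of_isLUB {c : ℕ → A} (hc : Pairwise fun k l => Disjoint (c k) (c l))
    {M M' : Set ℕ} {s s' : A} (hs : IsLUB (c '' M) s) (hs' : IsLUB (c '' M') s')
    {F F' : Finset ℕ} (hF : ∀ l ∈ M, l ∈ M' → l ∈ F ∧ l ∈ F') :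
    Disjoint (s \ F.sup c) (s' \ F'.sup c) := by
  have h1 : ∀ l' ∈ M', l' ∉ F' → Disjoint (s \ F.sup c) (c l') := by
    intro l' hl' hlF
    have : s ≤ (c l')ᶜ ⊔ F.sup c := by
      refine hs.2 ?_
      rintro _ ⟨l, hl, rfl⟩
      by_cases hlF' : l ∈ F
      · exact (Finset.le_sup hlF').trans le_sup_right
      · refine le_trans ?_ le_sup_left
        refine (hc ?_).le_compl_right
        rintro rfl
        exact hlF (hF l hl hl').2
    have h2 : s \ F.sup c ≤ (c l')ᶜ := by
      rw [sdiff_le_iff, sup_comm]; exact this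
    exact disjoint_compl_left.mono_left h2
  have h2 : s' ≤ (s \ F.sup c)ᶜ ⊔ F'.sup c := by
    refine hs'.2 ?_
    rintro _ ⟨l', hl', rfl⟩
    by_cases hlF' : l' ∈ F'
    · exact (Finset.le_sup hlF').trans le_sup_right
    · exact (h1 l' hl' hlF').symm.le_compl_right.trans le_sup_left
  have h3 : s' \ F'.sup c ≤ (s \ F.sup c)ᶜ := by
    rw [sdiff_le_iff, sup_comm]; exact h2
  exact (disjoint_compl_left.mono_left h3).symm

/-- If every disjoint sequence in `A` has a subsequence with a supremum, then the supremum `s` can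
be chosen such that a given bounded sequence of functionals `ψ k` does not distinguish `s` from the
`k`-th term of the sequence, up to `ε`. By Rosenthal's lemma the other terms of the subsequence
contribute little. The contribution of the "limit part" of `s` is made small by choosing among
uncountably many almost disjoint subsequences, whose limit parts are disjoint. -/
theorem exists_isLUB_approx
    (hsup : ∀ a : ℕ → A, (Pairwise fun m n => Disjoint (a m) (a n)) →
      ∃ M : Set ℕ, M.Infinite ∧ ∃ s : A, IsLUB (a '' M) s)
    (ψ : ℕ → C(StoneSpace A, ℝ) →L[ℝ] ℝ) {r : ℝ} (hψ : ∀ k, ‖ψ k‖ ≤ r)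
    (c : ℕ → A) (hc : Pairwise fun m n => Disjoint (c m) (c n)) {ε : ℝ} (hε : 0 < ε) :
    ∃ M : Set ℕ, M.Infinite ∧ ∃ s : A, ∀ k ∈ M, |ψ k (ind s) - ψ k (ind (c k))| ≤ ε := by
  have hdis : ∀ k l, k ≠ l → ∀ u, ind (c k) u = 0 ∨ ind (c l) u = 0 := fun k l hkl u =>
    ind_disjoint (hc hkl) u
  obtain ⟨N, -, hNinf, hN⟩ := exists_infinite_sum_abs_le (fun k l => ψ k (ind (c l)))
    (half_pos hε) (fun k F => (sum_abs_le_of_disjoint (ψ k) F (fun l => ind (c l))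
      (fun l _ => norm_ind_le _) fun l _ l' _ => hdis l l').trans (hψ k)) Set.infinite_univ
  obtain ⟨e, he, heN⟩ := exists_enum hNinf
  -- The subsequence of `N` along each branch, and a further subsequence with a supremum.
  have hM : ∀ b : ℕ → Bool, ∃ (M : Set ℕ) (s : A), M.Infinite ∧
      M ⊆ Set.range (fun i => e (branch b i)) ∧ IsLUB (c '' M) s := by
    intro b
    have hinj : Function.Injective fun i => e (branch b i) := he.comp (branch_injective b)
    obtain ⟨M, hM, s, hs⟩ := hsup (fun i => c (e (branch b i))) fun i j hij =>
      hc fun h => hij (hinj h)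
    refine ⟨(fun i => e (branch b i)) '' M, s, hM.image hinj.injOn, Set.image_subset_range _ _, ?_⟩
    rwa [← Set.image_comp]
  choose M s hMinf hMsub hs using hM
  have hMN : ∀ b, M b ⊆ N := by
    intro b l hl
    obtain ⟨i, rfl⟩ := hMsub b hl
    exact heN ▸ Set.mem_range_self _
  have had : ∀ b b', b ≠ b' → ∃ p, ∀ l ∈ M b, l ∈ M b' → l < p := by
    intro b b' hb
    obtain ⟨p, hp⟩ := exists_bound_branch hb
    have hfin : (e '' {n | n < p}).Finite := (Set.finite_lt_nat p).image _
    obtain ⟨q, hq⟩ := hfin.bddAbove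
    refine ⟨q + 1, fun l hl hl' => ?_⟩
    obtain ⟨i, rfl⟩ := hMsub b hl
    obtain ⟨i', hi'⟩ := hMsub b' hl'
    exact Nat.lt_succ_of_le (hq ⟨_, hp i i' (he hi').symm, rfl⟩)
  classical
  -- `b` is bad for `k` if `ψ k` is large on all the remainders of `s b`. The remainders for different
  -- `b` are eventually disjoint, so that only finitely many `b` are bad for a given `k`.
  let F : (ℕ → Bool) → ℕ → Finset ℕ := fun b p => (Finset.range p).filter (· ∈ M b)
  let bad : ℕ → Set (ℕ → Bool) := fun k =>
    {b | ∀ p > k, ε / 2 < |ψ k (ind (s b \ (F b p).sup c))|}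
  have hbad : ∀ k, (bad k).Finite := by
    intro k
    by_contra hinf
    obtain ⟨j, hj⟩ := exists_nat_ge (r / (ε / 2))
    obtain ⟨G, hG, hGj⟩ := Set.Infinite.exists_subset_card_eq hinf (j + 1)
    have hp : ∃ p, ∀ b ∈ G, ∀ b' ∈ G, b ≠ b' → ∀ l ∈ M b, l ∈ M b' → l < p := by
      choose! p hp using fun b b' => had b b'
      refine ⟨G.sup fun b => G.sup fun b' => p b b', fun b hb b' hb' hbb l hl hl' => ?_⟩
      refine (hp b b' hbb l hl hl').trans_le ?_
      exact (Finset.le_sup (f := fun b' => p b b') hb').trans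
        (Finset.le_sup (f := fun b => G.sup fun b' => p b b') hb)
    obtain ⟨p, hkp, hp⟩ : ∃ p > k, ∀ b ∈ G, ∀ b' ∈ G, b ≠ b' → ∀ l ∈ M b, l ∈ M b' → l < p := by
      obtain ⟨p, hp⟩ := hp
      exact ⟨max p (k + 1), by omega, fun b hb b' hb' hbb l hl hl' =>
        (hp b hb b' hb' hbb l hl hl').trans_le (le_max_left _ _)⟩
    have h1 := (sum_abs_le_of_disjoint (ψ k) G (fun b => ind (s b \ (F b p).sup c))
      (fun b _ => norm_ind_le _) fun b hb b' hb' hbb u => ind_disjoint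
        (disjoint_sdiff_of_isLUB hc (hs b) (hs b') fun l hl hl' => by
          have := hp b hb b' hb' hbb l hl hl'
          simp only [F, Finset.mem_filter, Finset.mem_range]
          exact ⟨⟨this, hl⟩, this, hl'⟩) u).trans (hψ k)
    have h2 : (j + 1) * (ε / 2) ≤ ∑ b ∈ G, |ψ k (ind (s b \ (F b p).sup c))| := by
      have := Finset.card_nsmul_le_sum G (fun b => |ψ k (ind (s b \ (F b p).sup c))|) (ε / 2)
        fun b hb => (hG hb p hkp).le
      rw [hGj, nsmul_eq_mul] at this
      exact_mod_cast this
    rw [div_le_iff₀ (half_pos hε)] at hj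
    linarith
  have hgood : ∃ b, ∀ k, b ∉ bad k := by
    by_contra! h
    refine not_countable_bool_seq ((Set.countable_iUnion fun k => (hbad k).countable).mono ?_)
    exact fun b _ => Set.mem_iUnion.2 (h b)
  obtain ⟨b, hb⟩ := hgood
  refine ⟨M b, hMinf b, s b, fun k hk => ?_⟩
  have hex : ∃ p > k, |ψ k (ind (s b \ (F b p).sup c))| ≤ ε / 2 := by
    by_contra! h
    exact hb k h
  obtain ⟨p, hkp, hp⟩ := hex
  have hFs : (F b p).sup c ≤ s b := Finset.sup_le fun l hl =>
    (hs b).1 ⟨l, (Finset.mem_filter.1 hl).2, rfl⟩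
  have hkF : k ∈ F b p := Finset.mem_filter.2 ⟨Finset.mem_range.2 hkp, hk⟩
  have h1 : ψ k (ind (s b)) = ψ k (ind (s b \ (F b p).sup c)) + (ψ k (ind (c k)) +
      ∑ l ∈ (F b p).erase k, ψ k (ind (c l))) := by
    rw [Finset.add_sum_erase _ (fun l => ψ k (ind (c l))) hkF, ← map_sum,
      ← ind_finset_sup _ _ fun l _ l' _ h => hc h, ← map_add,
      ← ind_sup disjoint_sdiff_self_left, sdiff_sup_cancel hFs]
  have h2 := hN k (hMN b hk) ((F b p).erase k) (by
    intro l hl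
    have hl' := Finset.mem_erase.1 (Finset.mem_coe.1 hl)
    exact ⟨hMN b (Finset.mem_filter.1 hl'.2).2, hl'.1⟩)
  rw [h1]
  calc |ψ k (ind (s b \ (F b p).sup c)) + (ψ k (ind (c k)) +
        ∑ l ∈ (F b p).erase k, ψ k (ind (c l))) - ψ k (ind (c k))|
      = |ψ k (ind (s b \ (F b p).sup c)) + ∑ l ∈ (F b p).erase k, ψ k (ind (c l))| := by ring_nf
    _ ≤ |ψ k (ind (s b \ (F b p).sup c))| + |∑ l ∈ (F b p).erase k, ψ k (ind (c l))| :=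
        abs_add_le _ _
    _ ≤ ε / 2 + ε / 2 := add_le_add hp ((Finset.abs_sum_le_sum_abs _ _).trans h2)
    _ = ε := add_halves ε

end Suprema

/-! ### The matrix of an operator on `C(K_+)` at a point -/

section Symbols

variable {A : Type*} [BooleanAlgebra A]

open StoneSpace

/-- The filter of the small elements of an ultrafilter `z`. -/
def germs {C : BooleanSubalgebra A} (z : StoneSpace C) : Filter C where
  sets := {S | ∃ c ∈ z.carrier, ∀ d ∈ z.carrier, d ≤ c → d ∈ S}
  univ_sets := ⟨⊤, z.top_mem, fun _ _ _ => trivial⟩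
  sets_of_superset := by
    rintro S T ⟨c, hc, h⟩ hST
    exact ⟨c, hc, fun d hd hdc => hST (h d hd hdc)⟩
  inter_sets := by
    rintro S T ⟨c, hc, h⟩ ⟨c', hc', h'⟩
    exact ⟨c ⊓ c', z.inf_mem hc hc', fun d hd hdc =>
      ⟨h d hd (hdc.trans inf_le_left), h' d hd (hdc.trans inf_le_right)⟩⟩

theorem eventually_germs {C : BooleanSubalgebra A} {z : StoneSpace C} {p : C → Prop} :
    (∀ᶠ c in germs z, p c) ↔ ∃ c ∈ z.carrier, ∀ d ∈ z.carrier, d ≤ c → p d := Iff.rfl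

theorem eventually_mem_germs {C : BooleanSubalgebra A} (z : StoneSpace C) :
    ∀ᶠ c in germs z, c ∈ z.carrier := ⟨⊤, z.top_mem, fun _ hd _ => hd⟩

theorem eventually_le_germs {C : BooleanSubalgebra A} {z : StoneSpace C} {c : C}
    (hc : c ∈ z.carrier) : ∀ᶠ d in germs z, d ≤ c := ⟨c, hc, fun _ _ h => h⟩

instance {C : BooleanSubalgebra A} (z : StoneSpace C) : (germs z).NeBot := by
  refine ⟨fun h => ?_⟩
  have h1 : ∀ᶠ _ in germs z, False := by rw [h]; exact eventually_bot
  obtain ⟨c, hc, h2⟩ := h1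
  exact h2 c hc le_rfl

/-- The functions `φ n m` are the symbol of the operator `U` on `C(K_+)` at the point `z`: near `z`
the entry of `U` from the `m`-th to the `n`-th summand is, up to small norm, multiplication by
`φ n m`. -/
def IsSymbolAt {C : BooleanSubalgebra A} (U : Xplus C →L[ℝ] Xplus C)
    (φ : ℕ → ℕ → C(StoneSpace A, ℝ)) (z : StoneSpace C) : Prop :=
  ∀ n m, ∀ ε > 0, ∀ᶠ c : C in germs z, ∀ g : C(StoneSpace A, ℝ),
    (∀ u : StoneSpace A, (c : A) ∉ u.carrier → g u = 0) →
      ‖coord C n (U (emb C m g)) - φ n m * g‖ ≤ ε * ‖g‖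

/-- If `C(K)` has few operators, then every operator on `C(K_+)` has a symbol, valid at all but
countably many points. -/
theorem exists_symbol (hfew : HasFewOperators (StoneSpace A)) {C : BooleanSubalgebra A}
    (U : Xplus C →L[ℝ] Xplus C) :
    ∃ φ : ℕ → ℕ → C(StoneSpace A, ℝ), {z | ¬ IsSymbolAt U φ z}.Countable := by
  choose φ S hS hφ using fun n m : ℕ => hfew ((coord C n).comp (U.comp (emb C m)))
  let bad : ℕ → ℕ → ℕ → Set (StoneSpace C) := fun n m i =>
    {z | ∀ c ∈ z.carrier, ∃ g : C(StoneSpace A, ℝ),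
      (∀ u : StoneSpace A, (c : A) ∉ u.carrier → g u = 0) ∧ 1 / (i + 1 : ℝ) * ‖g‖ < ‖S n m g‖}
  have hbad : ∀ n m i, (bad n m i).Finite := by
    intro n m i
    by_contra hinf
    obtain ⟨z, c, hzc, hc⟩ := exists_disjoint_seq hinf
    choose g hg hgS using fun k => (hzc k).1 (c k) (hzc k).2
    have hpos : ∀ k, 0 < ‖g k‖ := by
      intro k
      refine norm_pos_iff.2 fun h => ?_
      have := hgS k
      rw [h, map_zero, norm_zero, mul_zero] at this
      exact lt_irrefl _ this
    obtain ⟨k, hk⟩ := (hS n m).exists_norm_le (fun k => ‖g k‖⁻¹ • g k)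
      (fun k => by rw [norm_smul, norm_inv, norm_norm, inv_mul_cancel₀ (hpos k).ne'])
      (fun k l hkl u => by
        have hd : Disjoint (c k : A) (c l : A) :=
          disjoint_iff.2 (congrArg Subtype.val (disjoint_iff.1 (hc hkl)))
        by_cases hu : (c k : A) ∈ u.carrier
        · right
          rw [ContinuousMap.smul_apply, hg l u (u.notMem_of_disjoint hd hu), smul_zero]
        · left
          rw [ContinuousMap.smul_apply, hg k u hu, smul_zero])
      (ε := 1 / (i + 1 : ℝ)) (by positivity)
    rw [map_smul, norm_smul, norm_inv, norm_norm, inv_mul_le_iff₀ (hpos k)] at hk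
    have := hgS k
    rw [mul_comm] at this
    linarith
  refine ⟨φ, (Set.countable_iUnion fun n => Set.countable_iUnion fun m =>
    Set.countable_iUnion fun i => (hbad n m i).countable).mono fun z hz => ?_⟩
  by_contra hc
  simp only [Set.mem_iUnion, not_exists] at hc
  refine hz fun n m ε hε => ?_
  obtain ⟨i, hi⟩ := exists_nat_one_div_lt hε
  have h1 := hc n m i
  simp only [bad, Set.mem_ofPred_eq] at h1
  push Not at h1
  obtain ⟨c, hcz, h2⟩ := h1
  refine eventually_germs.2 ⟨c, hcz, fun d _ hdc g hg => ?_⟩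
  have h3 := hφ n m g
  have h4 : coord C n (U (emb C m g)) = φ n m * g + S n m g := h3
  rw [h4, add_sub_cancel_left]
  exact (h2 g fun u hu => hg u fun hd => hu (u.mem_of_le hd hdc)).trans
    (mul_le_mul_of_nonneg_right hi.le (norm_nonneg _))

variable {C : BooleanSubalgebra A} {U V : Xplus C →L[ℝ] Xplus C}
  {φ φ' : ℕ → ℕ → C(StoneSpace A, ℝ)}

theorem eventually_mem_of_res (x : StoneSpace A) :
    ∀ᶠ c : C in germs (res C x), (c : A) ∈ x.carrier := eventually_mem_germs _

theorem IsSymbolAt.tendsto {x : StoneSpace A} (h : IsSymbolAt U φ (res C x)) (n m : ℕ) :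
    Tendsto (fun c : C => coord C n (U (emb C m (ind (c : A)))) x) (germs (res C x))
      (𝓝 (φ n m x)) := by
  refine Metric.tendsto_nhds.2 fun ε hε => ?_
  filter_upwards [h n m (ε / 2) (half_pos hε), eventually_mem_of_res x] with c hc hcx
  have h1 := hc (ind (c : A)) fun u hu => ind_of_notMem hu
  have h2 := (ContinuousMap.norm_coe_le_norm _ x).trans h1
  rw [ContinuousMap.sub_apply, ContinuousMap.mul_apply, ind_of_mem hcx, mul_one] at h2
  rw [dist_eq_norm]
  have := norm_ind_le (c : A)
  have h3 : ε / 2 * ‖ind (c : A)‖ ≤ ε / 2 := mul_le_of_le_one_right (half_pos hε).le this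
  linarith

theorem IsSymbolAt.tendsto_mul {x : StoneSpace A} (hU : IsSymbolAt U φ (res C x))
    (hV : IsSymbolAt V φ' (res C x)) (n m l : ℕ) :
    Tendsto (fun c : C => coord C n (U (emb C m (coord C m (V (emb C l (ind (c : A))))))) x)
      (germs (res C x)) (𝓝 (φ n m x * φ' m l x)) := by
  refine Metric.tendsto_nhds.2 fun ε hε => ?_
  set δ : ℝ := ε / (2 * (‖U‖ + ‖φ' m l‖ + 1)) with hδ
  have hpos : 0 < ‖U‖ + ‖φ' m l‖ + 1 := by positivity
  have hδ0 : 0 < δ := by positivity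
  filter_upwards [hU n m δ hδ0, hV m l δ hδ0, eventually_mem_of_res x] with c hcU hcV hcx
  set i := ind (c : A) with hi
  have hin : ‖i‖ ≤ 1 := norm_ind_le _
  have h1 : ‖coord C m (V (emb C l i)) - φ' m l * i‖ ≤ δ :=
    (hcV i fun u hu => ind_of_notMem hu).trans (mul_le_of_le_one_right hδ0.le hin)
  have h2 : ‖coord C n (U (emb C m (φ' m l * i))) - φ n m * (φ' m l * i)‖ ≤ δ * ‖φ' m l‖ := by
    refine (hcU (φ' m l * i) fun u hu => ?_).trans (mul_le_mul_of_nonneg_left ?_ hδ0.le)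
    · rw [ContinuousMap.mul_apply, hi, ind_of_notMem hu, mul_zero]
    · exact (norm_mul_le _ _).trans (mul_le_of_le_one_right (norm_nonneg _) hin)
  have h3 : ‖coord C n (U (emb C m (coord C m (V (emb C l i)) - φ' m l * i)))‖ ≤ ‖U‖ * δ := by
    refine (norm_coord_apply_le _ _ _).trans ((U.le_opNorm _).trans ?_)
    exact mul_le_mul_of_nonneg_left ((norm_emb_le _ _ _).trans h1) (norm_nonneg _)
  have h2' := (ContinuousMap.norm_coe_le_norm _ x).trans h2
  have h3' := (ContinuousMap.norm_coe_le_norm _ x).trans h3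
  rw [ContinuousMap.sub_apply, ContinuousMap.mul_apply, ContinuousMap.mul_apply, hi,
    ind_of_mem hcx, mul_one, ← hi] at h2'
  rw [map_sub, map_sub, map_sub, ContinuousMap.sub_apply] at h3'
  rw [dist_eq_norm]
  have h4 : ‖U‖ * δ + δ * ‖φ' m l‖ < ε := by
    have : δ * (‖U‖ + ‖φ' m l‖ + 1) = ε / 2 := by
      rw [hδ]; field_simp
    nlinarith
  refine lt_of_le_of_lt ?_ h4
  refine le_trans ?_ (add_le_add h3' h2')
  refine le_trans (le_of_eq ?_) (norm_add_le _ _)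
  congr 1
  ring

theorem coord_sum_emb (F : Finset ℕ) (a : ℕ → ℝ) (g : C(StoneSpace A, ℝ)) (n : ℕ) :
    coord C n (∑ m ∈ F, a m • emb C m g) = if n ∈ F then a n • g else 0 := by
  rw [map_sum, ← Finset.sum_ite_eq F n fun m => a m • g]
  refine Finset.sum_congr rfl fun m _ => ?_
  rw [map_smul, coord_emb]
  split_ifs <;> simp

theorem norm_sum_emb_le (F : Finset ℕ) (a : ℕ → ℝ) (ha : ∀ m ∈ F, |a m| ≤ 1)
    {g : C(StoneSpace A, ℝ)} (hg : ‖g‖ ≤ 1) : ‖∑ m ∈ F, a m • emb C m g‖ ≤ 1 := by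
  refine norm_le_of_coord zero_le_one fun n => ?_
  rw [coord_sum_emb]
  split_ifs with h
  · rw [norm_smul]
    exact mul_le_one₀ (ha n h) (norm_nonneg _) hg
  · simp

theorem IsSymbolAt.tendsto_sum {x : StoneSpace A} (h : IsSymbolAt U φ (res C x)) (n : ℕ)
    (F : Finset ℕ) (a : ℕ → ℝ) :
    Tendsto (fun c : C => coord C n (U (∑ m ∈ F, a m • emb C m (ind (c : A)))) x)
      (germs (res C x)) (𝓝 (∑ m ∈ F, a m * φ n m x)) := by
  have := tendsto_finsetSum F fun m _ => (h.tendsto n m).const_mul (a m)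
  refine this.congr fun c => ?_
  rw [map_sum, map_sum, ContinuousMap.sum_apply]
  exact Finset.sum_congr rfl fun m _ => by
    rw [map_smul, map_smul, ContinuousMap.smul_apply, smul_eq_mul]

/-- The rows of the symbol are bounded in `ℓ_1`. -/
theorem IsSymbolAt.sum_abs_le {x : StoneSpace A} (h : IsSymbolAt U φ (res C x)) (n : ℕ)
    (F : Finset ℕ) : ∑ m ∈ F, |φ n m x| ≤ ‖U‖ := by
  choose σ hσ hσ' using fun m => exists_sign (φ n m x)
  have h1 := h.tendsto_sum n F σ
  rw [Finset.sum_congr rfl fun m _ => hσ' m] at h1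
  refine le_of_tendsto h1 (Eventually.of_forall fun c => ?_)
  refine (le_abs_self _).trans ((abs_coord_apply_le _ _ _ _).trans ((U.le_opNorm _).trans ?_))
  exact mul_le_of_le_one_right (norm_nonneg _)
    (norm_sum_emb_le F σ (fun m _ => hσ m) (norm_ind_le _))

theorem IsSymbolAt.abs_le {x : StoneSpace A} (h : IsSymbolAt U φ (res C x)) (n m : ℕ) :
    |φ n m x| ≤ ‖U‖ := by
  simpa using h.sum_abs_le n {m}

theorem IsSymbolAt.summable {x : StoneSpace A} (h : IsSymbolAt U φ (res C x)) (n : ℕ) :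
    Summable fun m => |φ n m x| :=
  summable_of_sum_le (fun _ => abs_nonneg _) (h.sum_abs_le n)

theorem IsSymbolAt.tsum_abs_le {x : StoneSpace A} (h : IsSymbolAt U φ (res C x)) (n : ℕ) :
    ∑' m, |φ n m x| ≤ ‖U‖ := (h.summable n).tsum_le_of_sum_le (h.sum_abs_le n)

/-! ### Multiplication by bounded sequences -/

/-- An increasing sequence `q` with `q 0 = 0` cuts `ℕ` into blocks; `κ m` is the number of the block
that contains `m`. -/
theorem exists_block (q : ℕ → ℕ) (hq : StrictMono q) (hq0 : q 0 = 0) :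
    ∃ κ : ℕ → ℕ, ∀ m k, κ m = k ↔ q k ≤ m ∧ m < q (k + 1) := by
  refine ⟨fun m => Nat.findGreatest (fun k => q k ≤ m) m, fun m k => ?_⟩
  have hle : ∀ k, k ≤ q k := fun k => hq.le_apply
  have hs : q (Nat.findGreatest (fun k => q k ≤ m) m) ≤ m :=
    Nat.findGreatest_spec (P := fun k => q k ≤ m) (Nat.zero_le m) (by simp [hq0])
  constructor
  · rintro rfl
    refine ⟨hs, ?_⟩
    by_contra! hc
    have := Nat.le_findGreatest (P := fun k => q k ≤ m) ((hle _).trans hc) hc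
    simp at this
  · rintro ⟨h1, h2⟩
    have h3 := Nat.le_findGreatest (P := fun k => q k ≤ m) ((hle k).trans h1) h1
    refine le_antisymm ?_ h3
    have := hq.lt_iff_lt.1 (hs.trans_lt h2)
    exact Nat.lt_succ_iff.1 this

/-- Multiplication of `u ∈ C(K_+)` by the sequences that are constant on the fibres of `κ`. -/
theorem exists_linf_mul (κ : ℕ → ℕ) (u : Xplus C) :
    ∃ H : Linf →L[ℝ] Xplus C, ∀ a m, coord C m (H a) = a (κ m) • coord C m u := by
  obtain ⟨H, -, hH⟩ := exists_clm_coord (W := Linf) C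
    (fun m => { toFun := fun a => a (κ m) • coord C m u
                map_add' := fun a b => by rw [Linf.add_apply, add_smul]
                map_smul' := fun c a => by rw [Linf.smul_apply, mul_smul]; rfl }) ‖u‖
    (fun m a => by
      show ‖a (κ m) • coord C m u‖ ≤ _
      rw [norm_smul, mul_comm]
      exact mul_le_mul (norm_coord_apply_le _ _ _) (Linf.abs_le _ _) (norm_nonneg _)
        (norm_nonneg _))
    (fun a ε hε => by
      obtain ⟨N, hN⟩ := asympInv_coord C u (ε / (‖a‖ + 1)) (by positivity)
      refine ⟨N, fun n hn x y hxy => ?_⟩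
      show |(a (κ n) • coord C n u) x - (a (κ n) • coord C n u) y| ≤ ε
      rw [ContinuousMap.smul_apply, ContinuousMap.smul_apply, ← smul_sub, smul_eq_mul, abs_mul]
      have h1 := hN n hn x y hxy
      have h2 := Linf.abs_le a (κ n)
      have h3 : 0 < ‖a‖ + 1 := by positivity
      calc |a (κ n)| * |coord C n u x - coord C n u y| ≤ (‖a‖ + 1) * (ε / (‖a‖ + 1)) :=
            mul_le_mul (by linarith) h1 (abs_nonneg _) h3.le
        _ = ε := by field_simp)
  exact ⟨H, hH⟩

theorem cut_ge_eq (p : ℕ) (f : Xplus C) :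
    cut C {m | p ≤ m} f = f - ∑ m ∈ Finset.range p, emb C m (coord C m f) := by
  refine ext_coord fun n => ?_
  rw [coord_cut, map_sub, map_sum]
  simp only [coord_emb, Finset.sum_ite_eq, Finset.mem_range, Set.mem_ofPred_eq]
  split_ifs with h1 h2 h2
  · omega
  · rw [sub_zero]
  · rw [sub_self]
  · omega

theorem cut_ge_eq_add {p q : ℕ} (hpq : p ≤ q) (f : Xplus C) :
    cut C {m | p ≤ m} f = cut C {m | p ≤ m ∧ m < q} f + cut C {m | q ≤ m} f := by
  refine ext_coord fun n => ?_
  rw [map_add, coord_cut, coord_cut, coord_cut]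
  simp only [Set.mem_ofPred_eq]
  split_ifs <;> first | omega | simp

end Symbols

/-! ### The matrix of a product -/

section Product

variable {A : Type*} [BooleanAlgebra A]

open StoneSpace

variable {C : BooleanSubalgebra A}

/-- The operator `a ↦ ∑ a k • (v k restricted to the summands with index at least μ k)` from `ℓ_∞`
to `C(K_+)`. The series has finitely many terms on each summand of `K_+`. It is asymptotically
invariant since `v k` is `2⁻ᵏ`-invariant from the index `μ k` on. -/
theorem exists_linf_tails (v : ℕ → Xplus C) (μ : ℕ → ℕ) (hμ : ∀ k, k ≤ μ k) {r : ℝ}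
    (hv : ∀ m (F : Finset ℕ) (a : Linf), ‖∑ k ∈ F, a k • coord C m (v k)‖ ≤ r * ‖a‖)
    (hinv : ∀ k, ∀ m ≥ μ k, ∀ x y, res C x = res C y →
      |coord C m (v k) x - coord C m (v k) y| ≤ (1 / 2) ^ k) :
    ∃ H : Linf →L[ℝ] Xplus C, ∀ k, H (Linf.unit k) = cut C {m | μ k ≤ m} (v k) := by
  classical
  let F : ℕ → Finset ℕ := fun m => (Finset.range (m + 1)).filter fun k => μ k ≤ m
  have hF : ∀ m k, k ∈ F m ↔ μ k ≤ m := by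
    intro m k
    simp only [F, Finset.mem_filter, Finset.mem_range, and_iff_right_iff_imp]
    intro h
    exact Nat.lt_succ_of_le ((hμ k).trans h)
  obtain ⟨H, -, hH⟩ := exists_clm_coord (W := Linf) C
    (fun m => { toFun := fun a => ∑ k ∈ F m, a k • coord C m (v k)
                map_add' := fun a b => by
                  rw [← Finset.sum_add_distrib]
                  exact Finset.sum_congr rfl fun k _ => by rw [Linf.add_apply, add_smul]
                map_smul' := fun c a => by
                  rw [Finset.smul_sum]
                  exact Finset.sum_congr rfl fun k _ => by
                    rw [Linf.smul_apply, mul_smul]; rfl }) r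
    (fun m a => hv m (F m) a)
    (fun a ε hε => by
      have hpos : 0 < ‖a‖ + 1 := by positivity
      obtain ⟨s, hs⟩ := summable_iff_vanishing_norm.1 (summable_geometric_two)
        (ε / (2 * (‖a‖ + 1))) (by positivity)
      have hfin : ∀ k, ∃ N, ∀ n ≥ N, ∀ x y, res C x = res C y →
          |coord C n (v k) x - coord C n (v k) y| ≤ ε / (2 * (‖a‖ + 1)) / (s.card + 1) := fun k =>
        asympInv_coord C (v k) _ (by positivity)
      choose N hN using hfin
      refine ⟨s.sup N, fun n hn x y hxy => ?_⟩
      show |(∑ k ∈ F n, a k • coord C n (v k)) x - (∑ k ∈ F n, a k • coord C n (v k)) y| ≤ ε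
      rw [ContinuousMap.sum_apply, ContinuousMap.sum_apply, ← Finset.sum_sub_distrib]
      have hterm : ∀ k, |(a k • coord C n (v k)) x - (a k • coord C n (v k)) y| ≤
          (‖a‖ + 1) * |coord C n (v k) x - coord C n (v k) y| := by
        intro k
        rw [ContinuousMap.smul_apply, ContinuousMap.smul_apply, ← smul_sub, smul_eq_mul, abs_mul]
        exact mul_le_mul_of_nonneg_right ((Linf.abs_le a k).trans (by linarith)) (abs_nonneg _)
      refine (Finset.abs_sum_le_sum_abs _ _).trans ((Finset.sum_le_sum fun k _ => hterm k).trans ?_)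
      rw [← Finset.mul_sum]
      have h1 : ∑ k ∈ F n ∩ s, |coord C n (v k) x - coord C n (v k) y| ≤
          ε / (2 * (‖a‖ + 1)) := by
        have hb : 0 ≤ ε / (2 * (‖a‖ + 1)) / (s.card + 1) := by positivity
        calc ∑ k ∈ F n ∩ s, |coord C n (v k) x - coord C n (v k) y|
            ≤ ∑ k ∈ F n ∩ s, ε / (2 * (‖a‖ + 1)) / (s.card + 1) :=
              Finset.sum_le_sum fun k hk => hN k n
                ((Finset.le_sup (Finset.mem_inter.1 hk).2).trans hn) x y hxy
          _ = (F n ∩ s).card * (ε / (2 * (‖a‖ + 1)) / (s.card + 1)) := by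
              rw [Finset.sum_const, nsmul_eq_mul]
          _ ≤ (s.card + 1) * (ε / (2 * (‖a‖ + 1)) / (s.card + 1)) := by
              refine mul_le_mul_of_nonneg_right ?_ hb
              have : (F n ∩ s).card ≤ s.card := Finset.card_le_card Finset.inter_subset_right
              have : ((F n ∩ s).card : ℝ) ≤ s.card := by exact_mod_cast this
              linarith
          _ = ε / (2 * (‖a‖ + 1)) := by field_simp
      have h2 : ∑ k ∈ F n \ s, |coord C n (v k) x - coord C n (v k) y| ≤
          ε / (2 * (‖a‖ + 1)) := by
        refine le_trans (Finset.sum_le_sum fun k hk =>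
          hinv k n ((hF n k).1 (Finset.mem_sdiff.1 hk).1) x y hxy) ?_
        exact (le_abs_self _).trans (hs (F n \ s) Finset.sdiff_disjoint).le
      rw [← Finset.sum_inter_add_sum_sdiff (F n) s]
      calc (‖a‖ + 1) * (∑ k ∈ F n ∩ s, |coord C n (v k) x - coord C n (v k) y| +
            ∑ k ∈ F n \ s, |coord C n (v k) x - coord C n (v k) y|)
          ≤ (‖a‖ + 1) * (ε / (2 * (‖a‖ + 1)) + ε / (2 * (‖a‖ + 1))) :=
            mul_le_mul_of_nonneg_left (add_le_add h1 h2) hpos.le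
        _ = ε := by field_simp; ring)
  refine ⟨H, fun k => ext_coord fun m => ?_⟩
  rw [hH, coord_cut]
  show ∑ j ∈ F m, Linf.unit k j • coord C m (v j) = _
  simp only [Linf.unit_apply, ite_smul, one_smul, zero_smul, Finset.sum_ite_eq', hF,
    Set.mem_ofPred_eq]
  split_ifs <;> rfl

/-- The key step for the matrix of a product: a tail of `V` between the `l`-th and the `n`-th
summand cannot contribute to `U ∘ V` at infinitely many points. If it did, by disjointness one
could choose blocks `[p k, q (k + 1))` and elements `d k` such that the image `v k` under `V` of the
indicator function of `d k` is almost invariant from `q (k + 1)` on. The parts from `q (k + 1)` on are summed by `exists_linf_tails`; the parts on the blocks are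
summed by multiplying with bounded sequences the image under `V` of the indicator function of a
supremum `s` of a subsequence of the `d k`. Since there is no copy of `ℓ_∞` in `C(K)`, both parts are eventually small. -/
theorem not_tails_large (hlinfty : ¬ ContainsLinfty C(StoneSpace A, ℝ))
    (hsup : ∀ a : ℕ → A, (Pairwise fun m n => Disjoint (a m) (a n)) →
      ∃ M : Set ℕ, M.Infinite ∧ ∃ s : A, IsLUB (a '' M) s)
    (U V : Xplus C →L[ℝ] Xplus C) (n l : ℕ) {ε : ℝ} (hε : 0 < ε) (c : ℕ → C)
    (hc : Pairwise fun i k => Disjoint (c i) (c k)) (x : ℕ → StoneSpace A)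
    (htail : ∀ k p, ∃ p' ≥ p, ∃ d ≤ c k,
      ε < |coord C n (U (cut C {m | p' ≤ m} (V (emb C l (ind (d : A)))))) (x k)|) : False := by
  have hex : ∀ k p, ∃ p' ≥ p, ∃ d ≤ c k, ∃ μ > p',
      ε < |coord C n (U (cut C {m | p' ≤ m} (V (emb C l (ind (d : A)))))) (x k)| ∧
      ∀ m ≥ μ, ∀ x y, res C x = res C y → |coord C m (V (emb C l (ind (d : A)))) x -
        coord C m (V (emb C l (ind (d : A)))) y| ≤ (1 / 2) ^ k := by
    intro k p
    obtain ⟨p', hp', d, hd, h⟩ := htail k p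
    obtain ⟨N, hN⟩ := asympInv_coord C (V (emb C l (ind (d : A)))) ((1 / 2) ^ k) (by positivity)
    exact ⟨p', hp', d, hd, max N (p' + 1), by omega, h, fun m hm =>
      hN m (le_of_max_le_left hm)⟩
  choose p' hp' d' hd' μ' hμ' hbig hinv using hex
  let q : ℕ → ℕ := fun k => Nat.rec 0 (fun k r => μ' k r) k
  have hq0 : q 0 = 0 := rfl
  have hq1 : ∀ k, q (k + 1) = μ' k (q k) := fun _ => rfl
  have hq : StrictMono q := strictMono_nat_of_lt_succ fun k => by
    rw [hq1]; exact (hp' k (q k)).trans_lt (hμ' k (q k))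
  set p : ℕ → ℕ := fun k => p' k (q k) with hp
  set d : ℕ → C := fun k => d' k (q k) with hd
  have hqp : ∀ k, q k ≤ p k := fun k => hp' k (q k)
  have hpq : ∀ k, p k ≤ q (k + 1) := fun k => (hμ' k (q k)).le
  have hdd : Pairwise fun i k => Disjoint (d i : A) (d k : A) := fun i k hik =>
    disjoint_iff.2 (congrArg Subtype.val (disjoint_iff.1
      ((hc hik).mono (hd' i (q i)) (hd' k (q k)))))
  let v : ℕ → Xplus C := fun k => V (emb C l (ind (d k : A)))
  -- The parts from `q (k + 1)` on.
  obtain ⟨H, hH⟩ := exists_linf_tails v (fun k => q (k + 1))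
    (fun k => (Nat.le_succ k).trans hq.le_apply) (r := ‖V‖) (fun m F a => by
      have h1 : ∑ k ∈ F, a k • coord C m (v k) =
          coord C m (V (emb C l (∑ k ∈ F, a k • ind (d k : A)))) := by
        simp only [map_sum, map_smul, v]
      rw [h1]
      refine (norm_coord_apply_le _ _ _).trans ((V.le_opNorm _).trans
        (mul_le_mul_of_nonneg_left ((norm_emb_le _ _ _).trans ?_) (norm_nonneg _)))
      exact norm_sum_le_of_disjoint F a _ (norm_nonneg _) (fun k _ => Linf.abs_le a k)
        (fun k _ => norm_ind_le _) fun k _ k' _ hk u => ind_disjoint (hdd hk) u)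
    (fun k => hinv k (q k))
  have hfin1 := finite_setOf_lt_norm_unit hlinfty ((coord C n).comp (U.comp H)) (half_pos hε)
  -- The parts on the blocks `[p k, q (k + 1))`.
  let ψ : ℕ → C(StoneSpace A, ℝ) →L[ℝ] ℝ := fun k => (ContinuousMap.evalCLM ℝ (x k)).comp
    ((coord C n).comp (U.comp ((cut C {m | p k ≤ m ∧ m < q (k + 1)}).comp (V.comp (emb C l)))))
  have hψv : ∀ k g, ψ k g = coord C n (U (cut C {m | p k ≤ m ∧ m < q (k + 1)}
      (V (emb C l g)))) (x k) := fun _ _ => rfl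
  have hψ : ∀ k, ‖ψ k‖ ≤ ‖U‖ * ‖V‖ := fun k =>
    ContinuousLinearMap.opNorm_le_bound _ (by positivity) fun g => by
      rw [hψv, Real.norm_eq_abs]
      refine (abs_coord_apply_le _ _ _ _).trans ((U.le_opNorm _).trans ?_)
      rw [mul_assoc]
      refine mul_le_mul_of_nonneg_left ((norm_cut_le _ _ _).trans ((V.le_opNorm _).trans ?_))
        (norm_nonneg _)
      exact mul_le_mul_of_nonneg_left (norm_emb_le _ _ _) (norm_nonneg _)
  obtain ⟨M, hM, s, hs⟩ := exists_isLUB_approx hsup ψ hψ (fun k => (d k : A)) hdd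
    (ε := ε / 4) (by positivity)
  obtain ⟨κ, hκ⟩ := exists_block q hq hq0
  obtain ⟨H', hH'⟩ := exists_linf_mul κ (cut C {m | p (κ m) ≤ m} (V (emb C l (ind s))))
  have hfin2 := finite_setOf_lt_norm_unit hlinfty ((coord C n).comp (U.comp H'))
    (ε := ε / 4) (by positivity)
  have hH'u : ∀ k, H' (Linf.unit k) =
      cut C {m | p k ≤ m ∧ m < q (k + 1)} (V (emb C l (ind s))) := by
    intro k
    refine ext_coord fun m => ?_
    rw [hH', coord_cut, coord_cut, Linf.unit_apply]
    simp only [Set.mem_ofPred_eq]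
    by_cases hk : κ m = k
    · have := (hκ m k).1 hk
      subst hk
      rw [if_pos rfl, one_smul]
      simp [this.2]
    · rw [if_neg hk, zero_smul, if_neg]
      rintro ⟨h1, h2⟩
      exact hk ((hκ m k).2 ⟨(hqp k).trans h1, h2⟩)
  obtain ⟨k, hkM, hk⟩ := (hM.sdiff (hfin1.union hfin2)).nonempty
  rw [Set.mem_union, not_or] at hk
  have h1 : |coord C n (U (cut C {m | q (k + 1) ≤ m} (v k))) (x k)| ≤ ε / 2 := by
    rw [← hH]
    by_contra! h
    exact hk.1 ⟨x k, h⟩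
  have h2 : |ψ k (ind s)| ≤ ε / 4 := by
    rw [hψv, ← hH'u]
    by_contra! h
    exact hk.2 ⟨x k, h⟩
  have h3 : ε < |coord C n (U (cut C {m | p k ≤ m} (v k))) (x k)| := hbig k (q k)
  rw [cut_ge_eq_add (hpq k), map_add, map_add, ContinuousMap.add_apply] at h3
  have h4 : coord C n (U (cut C {m | p k ≤ m ∧ m < q (k + 1)} (v k))) (x k) =
    ψ k (ind (d k : A)) := rfl
  rw [h4] at h3
  have h5 := hs k hkM
  have h6 := h3.trans_le (abs_add_le _ _)
  have h7 : |ψ k (ind (d k : A))| ≤ |ψ k (ind s)| + |ψ k (ind s) - ψ k (ind (d k : A))| := by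
    have := abs_sub (ψ k (ind s)) (ψ k (ind s) - ψ k (ind (d k : A)))
    rwa [sub_sub_cancel] at this
  linarith

/-- At all but countably many points, the matrix of a product of two operators is the product of
their matrices. -/
theorem countable_not_mul (hlinfty : ¬ ContainsLinfty C(StoneSpace A, ℝ))
    (hsup : ∀ a : ℕ → A, (Pairwise fun m n => Disjoint (a m) (a n)) →
      ∃ M : Set ℕ, M.Infinite ∧ ∃ s : A, IsLUB (a '' M) s)
    {U V : Xplus C →L[ℝ] Xplus C} {φ φ' : ℕ → ℕ → C(StoneSpace A, ℝ)}
    (hU : {z | ¬ IsSymbolAt U φ z}.Countable) (hV : {z | ¬ IsSymbolAt V φ' z}.Countable)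
    (χ : ℕ → ℕ → StoneSpace A → ℝ)
    (hχ : ∀ n l x, Tendsto (fun c : C => coord C n (U (V (emb C l (ind (c : A))))) x)
      (germs (res C x)) (𝓝 (χ n l x))) :
    {z | ¬ ∀ x, res C x = z → ∀ n l, ∑' m, φ n m x * φ' m l x = χ n l x}.Countable := by
  let bad : ℕ → ℕ → ℕ → Set (StoneSpace C) := fun n l i =>
    {z | IsSymbolAt U φ z ∧ IsSymbolAt V φ' z ∧ ∃ x, res C x = z ∧
      1 / (i + 1 : ℝ) < |χ n l x - ∑' m, φ n m x * φ' m l x|}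
  have hbad : ∀ n l i, (bad n l i).Finite := by
    intro n l i
    by_contra hinf
    obtain ⟨z, c, hzc, hc⟩ := exists_disjoint_seq hinf
    choose h1 h2 x hx hxi using fun k => (hzc k).1
    refine not_tails_large hlinfty hsup U V n l (ε := 1 / (i + 1 : ℝ)) (by positivity) c hc x ?_
    intro k p
    have hUk : IsSymbolAt U φ (res C (x k)) := hx k ▸ h1 k
    have hVk : IsSymbolAt V φ' (res C (x k)) := hx k ▸ h2 k
    have hsum : Summable fun m => φ n m (x k) * φ' m l (x k) := by
      refine Summable.of_norm_bounded ((hUk.summable n).mul_right ‖V‖) fun m => ?_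
      rw [norm_mul]
      exact mul_le_mul_of_nonneg_left (hVk.abs_le m l) (abs_nonneg _)
    have hlim : Tendsto (fun p => |χ n l (x k) -
        ∑ m ∈ Finset.range p, φ n m (x k) * φ' m l (x k)|) atTop
        (𝓝 |χ n l (x k) - ∑' m, φ n m (x k) * φ' m l (x k)|) :=
      (tendsto_const_nhds.sub hsum.hasSum.tendsto_sum_nat).abs
    obtain ⟨p', hp', hpp⟩ := ((hlim.eventually (eventually_gt_nhds (hxi k))).and
      (eventually_ge_atTop p)).exists
    have hlim2 : Tendsto (fun c : C => coord C n (U (cut C {m | p' ≤ m}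
        (V (emb C l (ind (c : A)))))) (x k)) (germs (res C (x k)))
        (𝓝 (χ n l (x k) - ∑ m ∈ Finset.range p', φ n m (x k) * φ' m l (x k))) := by
      have := (hχ n l (x k)).sub (tendsto_finsetSum (Finset.range p') fun m _ =>
        hUk.tendsto_mul hVk n m l)
      refine this.congr fun c => ?_
      rw [cut_ge_eq, map_sub, map_sub, map_sum, map_sum, ContinuousMap.sub_apply,
        ContinuousMap.sum_apply]
    have hck : c k ∈ (res C (x k)).carrier := by rw [hx k]; exact (hzc k).2
    obtain ⟨d, hd, hdc⟩ := ((hlim2.abs.eventually (eventually_gt_nhds hp')).and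
      (eventually_le_germs hck)).exists
    exact ⟨p', hpp, d, hdc, hd⟩
  refine ((hU.union hV).union (Set.countable_iUnion fun n => Set.countable_iUnion fun l =>
    Set.countable_iUnion fun i => (hbad n l i).countable)).mono fun z hz => ?_
  by_contra hcon
  simp only [Set.mem_union, Set.mem_iUnion, not_or, not_exists, Set.mem_ofPred_eq, not_not] at hcon
  refine hz fun x hx n l => ?_
  by_contra hne
  have hpos : 0 < |χ n l x - ∑' m, φ n m x * φ' m l x| :=
    abs_pos.2 (sub_ne_zero.2 (Ne.symm hne))
  obtain ⟨i, hi⟩ := exists_nat_one_div_lt hpos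
  exact hcon.2 n l i ⟨hcon.1.1, hcon.1.2, x, hx, hi⟩

end Product

/-! ### Comparison of the matrices at two points with the same trace -/

section Comparison

variable {A : Type*} [BooleanAlgebra A]

open StoneSpace

variable {C : BooleanSubalgebra A}

/-- The functional `f ↦ (U f)(n, x) - (U f)(n, y)` on `C(K_+)`. -/
noncomputable def diffAt (U : Xplus C →L[ℝ] Xplus C) (n : ℕ) (x y : StoneSpace A) :
    Xplus C →L[ℝ] ℝ :=
  (ContinuousMap.evalCLM ℝ x).comp ((coord C n).comp U) -
    (ContinuousMap.evalCLM ℝ y).comp ((coord C n).comp U)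

theorem diffAt_apply (U : Xplus C →L[ℝ] Xplus C) (n : ℕ) (x y : StoneSpace A) (f : Xplus C) :
    diffAt U n x y f = coord C n (U f) x - coord C n (U f) y := rfl

theorem abs_diffAt_le (U : Xplus C →L[ℝ] Xplus C) (n : ℕ) (x y : StoneSpace A) (f : Xplus C) :
    |diffAt U n x y f| ≤ 2 * ‖U‖ * ‖f‖ := by
  have h1 := (abs_coord_apply_le C n (U f) x).trans (U.le_opNorm f)
  have h2 := (abs_coord_apply_le C n (U f) y).trans (U.le_opNorm f)
  rw [diffAt_apply]
  exact (abs_sub _ _).trans (by linarith)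

/-- Each column of the matrix of `U` is asymptotically the same at points with the same trace on
`C`, for all but countably many traces. If this failed at infinitely many traces, then for a
suitable supremum `s` of a disjoint sequence, `U` would map the indicator function of `s` in the
`m`-th summand to a function that is not asymptotically invariant. -/
theorem countable_not_tendsto_sub
    (hsup : ∀ a : ℕ → A, (Pairwise fun m n => Disjoint (a m) (a n)) →
      ∃ M : Set ℕ, M.Infinite ∧ ∃ s : A, IsLUB (a '' M) s)
    {U : Xplus C →L[ℝ] Xplus C} {φ : ℕ → ℕ → C(StoneSpace A, ℝ)}
    (hU : {z | ¬ IsSymbolAt U φ z}.Countable) :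
    {z | ¬ ∀ x y, res C x = z → res C y = z → ∀ m,
      Tendsto (fun n => φ n m x - φ n m y) atTop (𝓝 0)}.Countable := by
  let bad : ℕ → ℕ → Set (StoneSpace C) := fun m i =>
    {z | IsSymbolAt U φ z ∧ ∃ x y, res C x = z ∧ res C y = z ∧
      ∀ N, ∃ n ≥ N, 1 / (i + 1 : ℝ) < |φ n m x - φ n m y|}
  have hbad : ∀ m i, (bad m i).Finite := by
    intro m i
    by_contra hinf
    obtain ⟨z, c, hzc, hc⟩ := exists_disjoint_seq hinf
    choose h1 x y hx hy hxy using fun k => (hzc k).1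
    choose n hn hnk using fun k => hxy k k
    set ε : ℝ := 1 / (i + 1 : ℝ) with hε
    have hε0 : 0 < ε := by positivity
    have hex : ∀ k, ∃ d ≤ c k, ε < |diffAt U (n k) (x k) (y k) (emb C m (ind (d : A)))| := by
      intro k
      have hxk : IsSymbolAt U φ (res C (x k)) := hx k ▸ h1 k
      have hyk : IsSymbolAt U φ (res C (y k)) := hy k ▸ h1 k
      have h2 := hxk.tendsto (n k) m
      have h3 := hyk.tendsto (n k) m
      rw [hx k] at h2
      rw [hy k] at h3
      obtain ⟨d, hd, hdc⟩ := (((h2.sub h3).abs.eventually (eventually_gt_nhds (hnk k))).and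
        (eventually_le_germs (hzc k).2)).exists
      exact ⟨d, hdc, hd⟩
    choose d hdc hd using hex
    have hdd : Pairwise fun i k => Disjoint (d i : A) (d k : A) := fun i k hik =>
      disjoint_iff.2 (congrArg Subtype.val (disjoint_iff.1 ((hc hik).mono (hdc i) (hdc k))))
    obtain ⟨M, hM, s, hs⟩ := exists_isLUB_approx hsup
      (fun k => (diffAt U (n k) (x k) (y k)).comp (emb C m)) (r := 2 * ‖U‖)
      (fun k => ContinuousLinearMap.opNorm_le_bound _ (by positivity) fun g =>
        (abs_diffAt_le _ _ _ _ _).trans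
          (mul_le_mul_of_nonneg_left (norm_emb_le _ _ _) (by positivity)))
      (fun k => (d k : A)) hdd (half_pos hε0)
    obtain ⟨N, hN⟩ := asympInv_coord C (U (emb C m (ind s))) (ε / 2) (half_pos hε0)
    obtain ⟨k, hkM, hk⟩ := hM.exists_gt N
    have h2 := hN (n k) (hk.le.trans (hn k)) (x k) (y k) ((hx k).trans (hy k).symm)
    have h3 := hs k hkM
    have h4 := hd k
    rw [← diffAt_apply] at h2
    have h5 : |diffAt U (n k) (x k) (y k) (emb C m (ind s)) -
      diffAt U (n k) (x k) (y k) (emb C m (ind (d k : A)))| ≤ ε / 2 := h3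
    have h6 := abs_sub (diffAt U (n k) (x k) (y k) (emb C m (ind s)))
      (diffAt U (n k) (x k) (y k) (emb C m (ind s)) -
        diffAt U (n k) (x k) (y k) (emb C m (ind (d k : A))))
    rw [sub_sub_cancel] at h6
    linarith
  refine (hU.union (Set.countable_iUnion fun m => Set.countable_iUnion fun i =>
    (hbad m i).countable)).mono fun z hz => ?_
  by_contra hcon
  simp only [Set.mem_union, Set.mem_iUnion, not_or, not_exists, Set.mem_ofPred_eq, not_not] at hcon
  refine hz fun x y hx hy m => Metric.tendsto_atTop.2 fun ε hε => ?_
  obtain ⟨i, hi⟩ := exists_nat_one_div_lt hε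
  by_contra! h
  refine hcon.2 m i ⟨hcon.1, x, y, hx, hy, fun N => ?_⟩
  obtain ⟨n, hn, hnε⟩ := h N
  rw [dist_zero_right, Real.norm_eq_abs] at hnε
  exact ⟨n, hn, hi.trans_le hnε⟩

/-- The rows of the matrix of `U` are asymptotically close in `ℓ_1` at points with the same trace on
`C`, for all but countably many traces. If this failed at infinitely many traces, a gliding hump
would yield disjoint elements of `C` and signs on disjoint blocks of summands whose combination
lies in `C(K_+)` and is mapped by `U` to a function that is not asymptotically invariant. -/
theorem countable_not_eventually_tsum_le
    (hsup : ∀ a : ℕ → A, (Pairwise fun m n => Disjoint (a m) (a n)) →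
      ∃ M : Set ℕ, M.Infinite ∧ ∃ s : A, IsLUB (a '' M) s)
    {U : Xplus C →L[ℝ] Xplus C} {φ : ℕ → ℕ → C(StoneSpace A, ℝ)}
    (hU : {z | ¬ IsSymbolAt U φ z}.Countable) {ε : ℝ} (hε : 0 < ε) :
    {z | ¬ ∀ x y, res C x = z → res C y = z → ∃ N, ∀ n ≥ N,
      ∑' m, |φ n m x - φ n m y| ≤ ε}.Countable := by
  let bad : Set (StoneSpace C) :=
    {z | IsSymbolAt U φ z ∧ (∀ x y, res C x = z → res C y = z → ∀ m,
      Tendsto (fun n => φ n m x - φ n m y) atTop (𝓝 0)) ∧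
      ∃ x y, res C x = z ∧ res C y = z ∧ ∀ N, ∃ n ≥ N, ε < ∑' m, |φ n m x - φ n m y|}
  have hbad : bad.Finite := by
    by_contra hinf
    obtain ⟨z, c, hzc, hc⟩ := exists_disjoint_seq hinf
    choose h1 hcol x y hx hy hxy using fun k => (hzc k).1
    have hex : ∀ k p, ∃ n ≥ k, ∃ q > p, ∃ σ : ℕ → ℝ, (∀ m, |σ m| ≤ 1) ∧ ∃ d ≤ c k,
        ε / 2 < |diffAt U n (x k) (y k) (∑ m ∈ Finset.Ico p q, σ m • emb C m (ind (d : A)))| := by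
      intro k p
      have hxk : IsSymbolAt U φ (res C (x k)) := hx k ▸ h1 k
      have hyk : IsSymbolAt U φ (res C (y k)) := hy k ▸ h1 k
      have hhead : Tendsto (fun n => ∑ m ∈ Finset.range p, |φ n m (x k) - φ n m (y k)|)
          atTop (𝓝 0) := by
        have := tendsto_finsetSum (Finset.range p) fun m _ => (hcol k _ _ (hx k) (hy k) m).abs
        simpa using this
      obtain ⟨N, hN⟩ := eventually_atTop.1 (hhead.eventually (eventually_lt_nhds (half_pos hε)))
      obtain ⟨n, hn, hnε⟩ := hxy k (max N k)
      have hsum : Summable fun m => |φ n m (x k) - φ n m (y k)| :=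
        Summable.of_nonneg_of_le (fun _ => abs_nonneg _) (fun m => abs_sub _ _)
          ((hxk.summable n).add (hyk.summable n))
      obtain ⟨q, hq, hpq⟩ := ((hsum.hasSum.tendsto_sum_nat.eventually
        (eventually_gt_nhds hnε)).and (eventually_gt_atTop p)).exists
      have hblock : ε / 2 < ∑ m ∈ Finset.Ico p q, |φ n m (x k) - φ n m (y k)| := by
        have h2 := hN n (le_of_max_le_left hn)
        rw [← Finset.sum_range_add_sum_Ico _ hpq.le] at hq
        linarith
      choose σ hσ hσ' using fun m => exists_sign (φ n m (x k) - φ n m (y k))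
      have h2 := hxk.tendsto_sum n (Finset.Ico p q) σ
      have h3 := hyk.tendsto_sum n (Finset.Ico p q) σ
      rw [hx k] at h2
      rw [hy k] at h3
      have h4 := h2.sub h3
      rw [← Finset.sum_sub_distrib, Finset.sum_congr rfl fun m _ => by
        rw [← mul_sub, hσ' m]] at h4
      obtain ⟨d, hd, hdc⟩ := ((h4.eventually (eventually_gt_nhds hblock)).and
        (eventually_le_germs (hzc k).2)).exists
      exact ⟨n, le_of_max_le_right hn, q, hpq, σ, hσ, d, hdc, hd.trans_le (le_abs_self _)⟩
    choose n' hn' q' hq' σ' hσ' d' hd' hbig using hex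
    let q : ℕ → ℕ := fun k => Nat.rec 0 (fun k r => q' k r) k
    have hq1 : ∀ k, q (k + 1) = q' k (q k) := fun _ => rfl
    have hq : StrictMono q := strictMono_nat_of_lt_succ fun k => by rw [hq1]; exact hq' k (q k)
    obtain ⟨κ, hκ⟩ := exists_block q hq rfl
    set n : ℕ → ℕ := fun k => n' k (q k)
    set d : ℕ → C := fun k => d' k (q k)
    set σ : ℕ → ℕ → ℝ := fun k => σ' k (q k)
    obtain ⟨u, hu⟩ := exists_coord_eq (C := C) (g := fun m => σ (κ m) m • ind (d (κ m) : A))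
      (r := 1) (fun δ hδ => ⟨0, fun m _ v w hvw => by
        have h2 : ind (d (κ m) : A) v = ind (d (κ m) : A) w := by
          have h3 : (d (κ m) : A) ∈ v.carrier ↔ (d (κ m) : A) ∈ w.carrier := by
            rw [← mem_res, ← mem_res, hvw]
          by_cases h : (d (κ m) : A) ∈ v.carrier
          · rw [ind_of_mem h, ind_of_mem (h3.1 h)]
          · rw [ind_of_notMem h, ind_of_notMem fun h' => h (h3.2 h')]
        rw [ContinuousMap.smul_apply, ContinuousMap.smul_apply, h2, sub_self, abs_zero]
        exact hδ.le⟩) (fun m => by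
        rw [norm_smul]
        exact mul_le_one₀ (hσ' _ _ _) (norm_nonneg _) (norm_ind_le _))
    obtain ⟨H, hH⟩ := exists_linf_mul κ u
    have hHu : ∀ k, H (Linf.unit k) =
        ∑ m ∈ Finset.Ico (q k) (q (k + 1)), σ k m • emb C m (ind (d k : A)) := by
      intro k
      refine ext_coord fun m => ?_
      rw [hH, coord_sum_emb, Linf.unit_apply, hu]
      have h2 : m ∈ Finset.Ico (q k) (q (k + 1)) ↔ κ m = k := by rw [Finset.mem_Ico, hκ]
      by_cases hk : κ m = k
      · rw [if_pos hk, if_pos (h2.2 hk), one_smul, hk]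
      · rw [if_neg hk, if_neg fun h => hk (h2.1 h), zero_smul]
    let ψ : ℕ → Linf →L[ℝ] ℝ := fun k => (diffAt U (n k) (x k) (y k)).comp H
    obtain ⟨N, -, hNinf, hN⟩ := exists_infinite_functional_le ψ (r := 2 * ‖U‖ * ‖H‖)
      (ε := ε / 4) (by positivity)
      (fun k => ContinuousLinearMap.opNorm_le_bound _ (by positivity) fun a => by
        refine (abs_diffAt_le _ _ _ _ _).trans ?_
        rw [mul_assoc _ ‖H‖]
        exact mul_le_mul_of_nonneg_left (H.le_opNorm a) (by positivity)) Set.infinite_univ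
    classical
    let t : Linf := Linf.mk (fun l => if l ∈ N then 1 else 0) (r := 1) fun l => by
      split_ifs <;> simp
    obtain ⟨K, hK⟩ := asympInv_coord C (U (H t)) (ε / 4) (by positivity)
    obtain ⟨k, hkN, hk⟩ := hNinf.exists_gt K
    have h2 := hK (n k) (hk.le.trans (hn' k (q k))) (x k) (y k) ((hx k).trans (hy k).symm)
    rw [← diffAt_apply] at h2
    have ht : ∀ l, (t - Linf.unit k) l = if l ∈ N \ {k} then 1 else 0 := by
      intro l
      rw [Linf.sub_apply, Linf.unit_apply]
      show (if l ∈ N then (1 : ℝ) else 0) - _ = _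
      by_cases hlk : l = k
      · subst hlk; simp [hkN]
      · simp [hlk]
    have h3 := hN k hkN (t - Linf.unit k)
      (Linf.norm_le zero_le_one fun l => by rw [ht]; split_ifs <;> simp)
      fun l hl => by rw [ht, if_neg hl]
    have h4 : ε / 2 < |ψ k (Linf.unit k)| := by
      show ε / 2 < |diffAt U (n k) (x k) (y k) (H (Linf.unit k))|
      rw [hHu]
      exact hbig k (q k)
    have h5 : |ψ k t| ≤ ε / 4 := h2
    rw [map_sub] at h3
    have h6 := abs_sub (ψ k t) (ψ k t - ψ k (Linf.unit k))
    rw [sub_sub_cancel] at h6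
    linarith
  refine ((hU.union (countable_not_tendsto_sub hsup hU)).union hbad.countable).mono fun z hz => ?_
  by_contra hcon
  simp only [Set.mem_union, not_or, Set.mem_ofPred_eq, not_not] at hcon
  refine hz fun x y hx hy => ?_
  by_contra! h
  exact hcon.2 ⟨hcon.1.1, hcon.1.2, x, y, hx, hy, h⟩

end Comparison

/-! ### The index argument -/

theorem summable_abs_mul_of_bdd {a t : ℕ → ℝ} {s : ℝ} (ha : Summable fun m => |a m|)
    (ht : ∀ m, |t m| ≤ s) : Summable fun m => |a m * t m| :=
  Summable.of_nonneg_of_le (fun _ => abs_nonneg _) (fun m => by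
    rw [abs_mul]
    exact mul_le_mul_of_nonneg_left (ht m) (abs_nonneg _)) (ha.mul_right s)

theorem abs_tsum_mul_le {a t : ℕ → ℝ} {r s : ℝ} (ha : Summable fun m => |a m|)
    (har : ∑' m, |a m| ≤ r) (ht : ∀ m, |t m| ≤ s) : |∑' m, a m * t m| ≤ r * s := by
  have hs : 0 ≤ s := (abs_nonneg _).trans (ht 0)
  have h := summable_abs_mul_of_bdd ha ht
  have h1 : |∑' m, a m * t m| ≤ ∑' m, |a m * t m| := by
    simp only [← Real.norm_eq_abs] at h ⊢
    exact norm_tsum_le_tsum_norm h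
  have h2 : ∑' m, |a m * t m| ≤ ∑' m, |a m| * s := h.tsum_le_tsum (fun m => by
    rw [abs_mul]
    exact mul_le_mul_of_nonneg_left (ht m) (abs_nonneg _)) (ha.mul_right s)
  rw [tsum_mul_right] at h2
  exact h1.trans (h2.trans (mul_le_mul_of_nonneg_right har hs))

/-- A matrix with rows bounded in `ℓ_1` defines an operator on `ℓ_∞`. -/
theorem exists_matrix_op (a : ℕ → ℕ → ℝ) {r : ℝ} (ha : ∀ n, Summable fun m => |a n m|)
    (har : ∀ n, ∑' m, |a n m| ≤ r) :
    ∃ T : Linf →L[ℝ] Linf, ‖T‖ ≤ r ∧ ∀ t n, T t n = ∑' m, a n m * t m := by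
  have hr : 0 ≤ r := (tsum_nonneg fun m => abs_nonneg (a 0 m)).trans (har 0)
  have hb : ∀ (t : Linf) n, |∑' m, a n m * t m| ≤ r * ‖t‖ := fun t n =>
    abs_tsum_mul_le (ha n) (har n) (Linf.abs_le t)
  let f : Linf →ₗ[ℝ] Linf :=
    { toFun := fun t => Linf.mk (fun n => ∑' m, a n m * t m) (hb t)
      map_add' := fun t t' => lp.ext (funext fun n => by
        show ∑' m, a n m * (t m + t' m) = ∑' m, a n m * t m + ∑' m, a n m * t' m
        rw [← (summable_abs_mul_of_bdd (ha n) (Linf.abs_le t)).of_abs.tsum_add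
          (summable_abs_mul_of_bdd (ha n) (Linf.abs_le t')).of_abs]
        exact tsum_congr fun m => mul_add _ _ _)
      map_smul' := fun c t => lp.ext (funext fun n => by
        show ∑' m, a n m * (c * t m) = c * ∑' m, a n m * t m
        rw [← tsum_mul_left]
        exact tsum_congr fun m => mul_left_comm _ _ _) }
  have hf : ∀ t, ‖f t‖ ≤ r * ‖t‖ := fun t =>
    Linf.norm_le (mul_nonneg hr (norm_nonneg t)) (hb t)
  exact ⟨f.mkContinuous r hf, LinearMap.mkContinuous_norm_le _ hr _, fun t n => rfl⟩

/-- Associativity of the product of two matrices with rows bounded in `ℓ_1` and a bounded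
sequence. -/
theorem tsum_mul_tsum (a b : ℕ → ℕ → ℝ) {r s : ℝ} (ha : ∀ n, Summable fun m => |a n m|)
    (hb : ∀ n, Summable fun m => |b n m|) (hbr : ∀ n, ∑' m, |b n m| ≤ r) (t : ℕ → ℝ)
    (ht : ∀ l, |t l| ≤ s) (n : ℕ) :
    ∑' m, a n m * ∑' l, b m l * t l = ∑' l, (∑' m, a n m * b m l) * t l := by
  have hs : 0 ≤ s := (abs_nonneg _).trans (ht 0)
  have hle : ∀ m l, |a n m * (b m l * t l)| ≤ |a n m| * (|b m l| * s) := fun m l => by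
    rw [abs_mul, abs_mul]
    exact mul_le_mul_of_nonneg_left (mul_le_mul_of_nonneg_left (ht l) (abs_nonneg _)) (abs_nonneg _)
  have h0 : ∀ m, Summable fun l => |a n m| * (|b m l| * s) := fun m =>
    ((hb m).mul_right s).mul_left _
  have h1 : ∀ m, Summable fun l => |a n m * (b m l * t l)| := fun m =>
    Summable.of_nonneg_of_le (fun _ => abs_nonneg _) (hle m) (h0 m)
  have h2 : ∀ m, ∑' l, |a n m * (b m l * t l)| ≤ |a n m| * (r * s) := fun m => by
    refine ((h1 m).tsum_le_tsum (hle m) (h0 m)).trans ?_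
    rw [tsum_mul_left, tsum_mul_right]
    exact mul_le_mul_of_nonneg_left (mul_le_mul_of_nonneg_right (hbr m) hs) (abs_nonneg _)
  have hsum : Summable fun p : ℕ × ℕ => |a n p.1 * (b p.1 p.2 * t p.2)| :=
    (summable_prod_of_nonneg fun _ => abs_nonneg _).2 ⟨h1,
      Summable.of_nonneg_of_le (fun m => tsum_nonneg fun _ => abs_nonneg _) h2
        ((ha n).mul_right _)⟩
  have hsum' : Summable (Function.uncurry fun m l => a n m * (b m l * t l)) := hsum.of_abs
  calc ∑' m, a n m * ∑' l, b m l * t l = ∑' m, ∑' l, a n m * (b m l * t l) :=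
        tsum_congr fun m => tsum_mul_left.symm
    _ = ∑' l, ∑' m, a n m * (b m l * t l) := hsum'.tsum_comm.symm
    _ = ∑' l, (∑' m, a n m * b m l) * t l := tsum_congr fun l => by
        rw [← tsum_mul_right]
        exact tsum_congr fun m => by ring

/-- A surjective perturbation of the identity by an operator of finite rank is injective. -/
theorem injective_of_surjective_add_id {E : Type*} [AddCommGroup E] [Module ℝ E] (S : E →ₗ[ℝ] E)
    [FiniteDimensional ℝ (LinearMap.range S)]
    (h : Function.Surjective (LinearMap.id + S : E →ₗ[ℝ] E)) :
    Function.Injective (LinearMap.id + S : E →ₗ[ℝ] E) := by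
  have hmaps : ∀ w ∈ LinearMap.range S, (LinearMap.id + S : E →ₗ[ℝ] E) w ∈ LinearMap.range S :=
    fun w hw => Submodule.add_mem _ hw ⟨w, rfl⟩
  let G := (LinearMap.id + S : E →ₗ[ℝ] E).restrict hmaps
  have hG : Function.Surjective G := by
    rintro ⟨w, hw⟩
    obtain ⟨v, hv⟩ := h w
    have hv' : v + S v = w := hv
    refine ⟨⟨v, ?_⟩, Subtype.ext hv⟩
    rw [eq_sub_of_add_eq hv']
    exact Submodule.sub_mem _ hw ⟨v, rfl⟩
  have hG' := LinearMap.injective_iff_surjective.2 hG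
  rw [injective_iff_map_eq_zero]
  intro v hv
  have hv' : v + S v = 0 := hv
  have hvr : v ∈ LinearMap.range S := by
    rw [eq_neg_of_add_eq_zero_left hv']
    exact Submodule.neg_mem _ ⟨v, rfl⟩
  have := (injective_iff_map_eq_zero G).1 hG' ⟨v, hvr⟩ (Subtype.ext hv)
  exact congrArg Subtype.val this

/-- Bounded sequences supported in a fixed finite set form a finite-dimensional space. -/
theorem finiteDimensional_range_of_forall_ge {R : Linf →L[ℝ] Linf} {N : ℕ}
    (hR : ∀ t, ∀ n ≥ N, R t n = 0) :
    FiniteDimensional ℝ (LinearMap.range (R : Linf →ₗ[ℝ] Linf)) := by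
  have hle : LinearMap.range (R : Linf →ₗ[ℝ] Linf) ≤
      Submodule.span ℝ (Linf.unit '' (Finset.range N : Set ℕ)) := by
    rintro _ ⟨t, rfl⟩
    have h1 : R t = ∑ i ∈ Finset.range N, R t i • Linf.unit i := by
      refine lp.ext (funext fun n => ?_)
      rw [lp.coeFn_sum, Finset.sum_apply]
      have h2 : ∀ i, (R t i • Linf.unit i) n = if n = i then R t i else 0 := fun i => by
        rw [Linf.smul_apply, Linf.unit_apply, mul_ite, mul_one, mul_zero]
      rw [Finset.sum_congr rfl fun i _ => h2 i, Finset.sum_ite_eq]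
      by_cases h : n ∈ Finset.range N
      · rw [if_pos h]
      · rw [if_neg h]
        exact hR t n (not_lt.1 fun h' => h (Finset.mem_range.2 h'))
    show R t ∈ _
    rw [h1]
    exact Submodule.sum_mem _ fun i hi => Submodule.smul_mem _ _ (Submodule.subset_span
      ⟨i, Finset.mem_coe.2 hi, rfl⟩)
  have : FiniteDimensional ℝ (Submodule.span ℝ (Linf.unit '' (Finset.range N : Set ℕ))) :=
    FiniteDimensional.span_of_finite ℝ ((Finset.finite_toSet _).image _)
  exact Submodule.finiteDimensional_of_le hle

/-- An invertible operator `F` on `ℓ_∞`, an operator `G` with right inverse, and a small operator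
`E` such that `G - F - E` has finite rank: then `G` is injective, as its index is that of `F`. -/
theorem injective_of_perturbation {F F' G G' E : Linf →L[ℝ] Linf} (hF : F * F' = 1)
    (hF' : F' * F = 1) (hG : G * G' = 1) (hE : ‖E‖ * ‖F'‖ < 1) {N : ℕ}
    (hN : ∀ t, ∀ n ≥ N, (G - F - E) t n = 0) : Function.Injective G := by
  have hF0 : 0 < ‖F'‖ := by
    refine norm_pos_iff.2 fun h => ?_
    rw [h, mul_zero] at hF
    have h1 := congrArg (fun T : Linf →L[ℝ] Linf => T (Linf.unit 0) 0) hF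
    simp [Linf.unit_apply] at h1
  let u : (Linf →L[ℝ] Linf)ˣ := ⟨F, F', hF, hF'⟩
  let w := u.add E (by
    show ‖E‖ < ‖F'‖⁻¹
    rw [← one_div, lt_div_iff₀ hF0]
    exact hE)
  have hw : (w : Linf →L[ℝ] Linf) = F + E := rfl
  set W : Linf →L[ℝ] Linf := ↑w⁻¹
  have hWw : W * (F + E) = 1 := by rw [← hw]; exact w.inv_mul
  have hfin := finiteDimensional_range_of_forall_ge hN
  let S : Linf →ₗ[ℝ] Linf := (W : Linf →ₗ[ℝ] Linf) ∘ₗ ((G - F - E : Linf →L[ℝ] Linf) : Linf →ₗ[ℝ] Linf)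
  have hS : LinearMap.id + S = ((W * G : Linf →L[ℝ] Linf) : Linf →ₗ[ℝ] Linf) := by
    have h1 : W * G = 1 + W * (G - F - E) := by
      rw [sub_sub, mul_sub, hWw]; abel
    rw [h1]
    rfl
  have hSfin : FiniteDimensional ℝ (LinearMap.range S) := by
    rw [LinearMap.range_comp]
    infer_instance
  have hsurj : Function.Surjective (LinearMap.id + S : Linf →ₗ[ℝ] Linf) := by
    rw [hS]
    intro t
    refine ⟨(G' * (F + E)) t, ?_⟩
    show (W * G * (G' * (F + E))) t = t
    rw [mul_assoc, ← mul_assoc G, hG, one_mul, hWw]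
    rfl
  have hinj := injective_of_surjective_add_id S hsurj
  rw [hS] at hinj
  exact Function.Injective.of_comp (f := W) hinj

theorem matrix_op_comp {a b c : ℕ → ℕ → ℝ} {r : ℝ} {S T : Linf →L[ℝ] Linf}
    (hS : ∀ t n, S t n = ∑' m, a n m * t m) (hT : ∀ t n, T t n = ∑' m, b n m * t m)
    (ha : ∀ n, Summable fun m => |a n m|) (hb : ∀ n, Summable fun m => |b n m|)
    (hbr : ∀ n, ∑' m, |b n m| ≤ r) (hc : ∀ n l, ∑' m, a n m * b m l = c n l) (t : Linf) (n : ℕ) :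
    (S * T) t n = ∑' l, c n l * t l := by
  show S (T t) n = _
  rw [hS]
  simp only [hT]
  rw [tsum_mul_tsum a b ha hb hbr t (Linf.abs_le t)]
  exact tsum_congr fun l => by rw [hc]

/-- A matrix `a` that is invertible after deletion of the `0`-th column cannot agree, up to finitely
many rows and a small error, with an invertible matrix `b`. -/
theorem not_rows_close {a a' b b' : ℕ → ℕ → ℝ} {r : ℝ}
    (ha : ∀ n, Summable fun m => |a n m|) (har : ∀ n, ∑' m, |a n m| ≤ r)
    (ha' : ∀ n, Summable fun m => |a' n m|) (har' : ∀ n, ∑' m, |a' n m| ≤ r)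
    (hb : ∀ n, Summable fun m => |b n m|) (hbr : ∀ n, ∑' m, |b n m| ≤ r)
    (hb' : ∀ n, Summable fun m => |b' n m|) (hbr' : ∀ n, ∑' m, |b' n m| ≤ r)
    (haa' : ∀ n l, ∑' m, a n m * a' m l = if n = l then 1 else 0)
    (ha'a : ∀ n l, ∑' m, a' n m * a m l = if n = 0 then 0 else if n = l then 1 else 0)
    (hbb' : ∀ n l, ∑' m, b n m * b' m l = if n = l then 1 else 0)
    (hb'b : ∀ n l, ∑' m, b' n m * b m l = if n = l then 1 else 0)
    {ε : ℝ} (hε : 0 ≤ ε) (hεr : ε * r < 1) {N : ℕ}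
    (hN : ∀ n ≥ N, ∑' m, |a n m - b n m| ≤ ε) : False := by
  obtain ⟨G, -, hG⟩ := exists_matrix_op a ha har
  obtain ⟨G', -, hG'⟩ := exists_matrix_op a' ha' har'
  obtain ⟨F, -, hF⟩ := exists_matrix_op b hb hbr
  obtain ⟨F', hF'r, hF'⟩ := exists_matrix_op b' hb' hbr'
  have hdiff : ∀ n, Summable fun m => |a n m - b n m| := fun n =>
    Summable.of_nonneg_of_le (fun _ => abs_nonneg _) (fun m => abs_sub _ _) ((ha n).add (hb n))
  obtain ⟨E, hEε, hE⟩ := exists_matrix_op (fun n m => if N ≤ n then a n m - b n m else 0) (r := ε)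
    (fun n => by
      by_cases h : N ≤ n
      · simpa only [if_pos h] using hdiff n
      · simpa only [if_neg h, abs_zero] using summable_zero)
    (fun n => by
      by_cases h : N ≤ n
      · simpa only [if_pos h] using hN n h
      · simpa only [if_neg h, abs_zero, tsum_zero] using hε)
  have hone : ∀ {S : Linf →L[ℝ] Linf}, (∀ t n, S t n = ∑' l, (if n = l then 1 else 0) * t l) →
      S = 1 := fun {S} h => by
    ext t n
    rw [h t n, tsum_eq_single n fun l hl => by rw [if_neg hl.symm, zero_mul], if_pos rfl, one_mul]
    rfl
  have hGG' : G * G' = 1 := hone (matrix_op_comp hG hG' ha ha' har' haa')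
  have hinj : Function.Injective G := by
    refine injective_of_perturbation (E := E) (N := N)
      (hone (matrix_op_comp hF hF' hb hb' hbr' hbb'))
      (hone (matrix_op_comp hF' hF hb' hb hbr hb'b)) hGG' ?_ ?_
    · exact (mul_le_mul hEε hF'r (norm_nonneg _) hε).trans_lt hεr
    · intro t n hn
      show G t n - F t n - E t n = 0
      rw [hG, hF, hE]
      simp only [if_pos hn]
      rw [← (summable_abs_mul_of_bdd (ha n) (Linf.abs_le t)).of_abs.tsum_sub
        (summable_abs_mul_of_bdd (hb n) (Linf.abs_le t)).of_abs, sub_eq_zero]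
      exact tsum_congr fun m => (sub_mul _ _ _).symm
  have hzero : (G' * G) (Linf.unit 0) = 0 := by
    refine lp.ext (funext fun n => ?_)
    rw [matrix_op_comp hG' hG ha' ha har ha'a]
    show _ = (0 : ℝ)
    refine (tsum_congr fun l => ?_).trans tsum_zero
    rw [Linf.unit_apply]
    split_ifs with h1 h2 h3 <;> first | (simp; done) | (exfalso; omega)
  have hG0 : G (Linf.unit 0) = 0 := by
    have h1 : (G * G' * G) (Linf.unit 0) = 0 := by
      rw [mul_assoc]
      show G ((G' * G) (Linf.unit 0)) = 0
      rw [hzero, map_zero]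
    rwa [hGG', one_mul] at h1
  have h1 : Linf.unit 0 = 0 := hinj (hG0.trans (map_zero G).symm)
  have h2 : Linf.unit 0 0 = (0 : Linf) 0 := by rw [h1]
  rw [Linf.unit_apply, Linf.zero_apply, if_pos rfl] at h2
  exact one_ne_zero h2

/-! ### The algebra of fixed points -/

section Fixed

variable {A : Type*} [BooleanAlgebra A]

open StoneSpace

/-- The Stone space of a nontrivial atomless algebra is not countable, by Baire's theorem. -/
theorem exists_notMem_of_countable {D : Type*} [BooleanAlgebra D] [Nontrivial D]
    (hD : ∀ c : D, c ≠ ⊥ → ∃ d ≤ c, d ≠ ⊥ ∧ d ≠ c) {Z : Set (StoneSpace D)} (hZ : Z.Countable) :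
    ∃ z, z ∉ Z := by
  obtain ⟨u, -⟩ := exists_mem (top_ne_bot : (⊤ : D) ≠ ⊥)
  have : Nonempty (StoneSpace D) := ⟨u⟩
  have hd : Dense (⋂ z ∈ Z, ({z}ᶜ : Set (StoneSpace D))) := by
    refine dense_biInter_of_isOpen (fun _ _ => isOpen_compl_singleton) hZ fun z _ => ?_
    rw [dense_compl_singleton_iff_not_open]
    intro hz
    obtain ⟨_, ⟨c, rfl⟩, hzc, hc⟩ :=
      isTopologicalBasis_basic.exists_subset_of_mem_open (Set.mem_singleton z) hz
    obtain ⟨d, hdc, hd0, hd1⟩ := hD c fun h => z.bot_notMem (h ▸ hzc)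
    obtain ⟨v, hv⟩ := exists_mem hd0
    have hsd : c \ d ≠ ⊥ := fun h => hd1 (le_antisymm hdc (sdiff_eq_bot_iff.1 h))
    obtain ⟨w, hw⟩ := exists_mem hsd
    have h1 : v = z := hc (v.mem_of_le hv hdc)
    have h2 : w = z := hc (w.mem_of_le hw sdiff_le)
    exact v.notMem_of_disjoint disjoint_sdiff_self_right hv (h1.trans h2.symm ▸ hw)
  obtain ⟨z, hz⟩ := hd.nonempty
  refine ⟨z, fun hzZ => ?_⟩
  rw [Set.mem_iInter₂] at hz
  exact hz z hzZ rfl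

theorem inf_ne_bot_of_mem_fixedAlgebra {B : BooleanSubalgebra A} {j : B ≃o B} {k₁ k₂ : A}
    (hk : IsCompl k₁ k₂) (hk₁ : k₁ ∈ B) (hk₂ : k₂ ∈ B) (hj₁ : j ⟨k₁, hk₁⟩ = ⟨k₂, hk₂⟩) {c : A}
    (hc : c ∈ fixedAlgebra B j) (hc0 : c ≠ ⊥) : c ⊓ k₁ ≠ ⊥ := by
  obtain ⟨hcB, hjc⟩ := hc
  intro h
  apply hc0
  have h1 : (⟨c, hcB⟩ : B) ⊓ ⟨k₁, hk₁⟩ = ⊥ := Subtype.ext h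
  have h2 := congrArg j h1
  rw [OrderIso.map_inf, hjc, hj₁] at h2
  have h3 : c ⊓ k₂ = ⊥ := congrArg Subtype.val (h2.trans (map_bot j))
  rw [← inf_top_eq c, ← hk.sup_eq_top, inf_sup_left, h, h3, sup_bot_eq]

/-- If `b ≤ k₁` belongs to `B`, then `b ⊔ j b` is a fixed point; this makes the algebra of fixed
points atomless. -/
theorem fixedAlgebra_atomless (hperf : PerfectSpace (StoneSpace A)) {B : BooleanSubalgebra A}
    (hdense : ∀ a : A, a ≠ ⊥ → ∃ b ∈ B, b ≠ ⊥ ∧ b ≤ a) {j : B ≃o B} {k₁ k₂ : A}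
    (hk : IsCompl k₁ k₂) (hk₁ : k₁ ∈ B) (hk₂ : k₂ ∈ B) (hj₁ : j ⟨k₁, hk₁⟩ = ⟨k₂, hk₂⟩)
    (hjj : ∀ b : B, j (j b) = b) (c : fixedAlgebra B j) (hc0 : c ≠ ⊥) :
    ∃ d ≤ c, d ≠ ⊥ ∧ d ≠ c := by
  have hcA : (c : A) ⊓ k₁ ≠ ⊥ := inf_ne_bot_of_mem_fixedAlgebra hk hk₁ hk₂ hj₁ c.2
    fun h => hc0 (Subtype.ext h)
  obtain ⟨u, hu⟩ := exists_mem hcA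
  obtain ⟨v, hv, hvu⟩ := ((mem_closure_iff_nhdsWithin_neBot.2
    (PerfectSpace.not_isolated u)) : u ∈ closure {u}ᶜ) |> fun h =>
      mem_closure_iff.1 h _ (isOpen_basic ((c : A) ⊓ k₁)) hu
  obtain ⟨_, ⟨a, rfl⟩, hva, ha⟩ := isTopologicalBasis_basic.exists_subset_of_mem_open
    (a := v) (u := basic ((c : A) ⊓ k₁) ∩ {u}ᶜ) ⟨hv, hvu⟩
    ((isOpen_basic _).inter isOpen_compl_singleton)
  have hle : ∀ w : StoneSpace A, a ∈ w.carrier → (c : A) ⊓ k₁ ∈ w.carrier := fun w hw => (ha hw).1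
  have hale : a ≤ (c : A) ⊓ k₁ := by
    rw [← sdiff_eq_bot_iff]
    by_contra h
    obtain ⟨w, hw⟩ := exists_mem h
    exact w.notMem_of_disjoint disjoint_sdiff_self_right (hle w (w.mem_of_le hw sdiff_le)) hw
  have hau : a ∉ u.carrier := fun h => (ha h).2 rfl
  obtain ⟨b, hbB, hb0, hba⟩ := hdense a fun h => v.bot_notMem (h ▸ hva)
  obtain ⟨hcB, hjc⟩ := c.2
  let b' : B := ⟨b, hbB⟩
  have hbc : b' ≤ ⟨c, hcB⟩ := (hba.trans hale).trans inf_le_left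
  have hbk : b' ≤ ⟨k₁, hk₁⟩ := (hba.trans hale).trans inf_le_right
  have hjbc : j b' ≤ ⟨c, hcB⟩ := by
    rw [← hjc]; exact j.monotone hbc
  have hjbk : j b' ≤ ⟨k₂, hk₂⟩ := by
    rw [← hj₁]; exact j.monotone hbk
  have hfix : j (b' ⊔ j b') = b' ⊔ j b' := by rw [OrderIso.map_sup, hjj, sup_comm]
  refine ⟨⟨((b' ⊔ j b' : B) : A), (b' ⊔ j b').2, hfix⟩, ?_, ?_, ?_⟩
  · exact sup_le hbc hjbc
  · intro h
    have h1 : ((b' ⊔ j b' : B) : A) = ⊥ := congrArg Subtype.val h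
    exact hb0 (le_bot_iff.1 (h1 ▸ (le_sup_left : b' ≤ b' ⊔ j b')))
  · intro h
    have h1 : ((b' ⊔ j b' : B) : A) = c := congrArg Subtype.val h
    have h2 : b ⊔ (j b' : A) = c := h1
    have h3 : b ⊔ (j b' : A) ∈ u.carrier := h2 ▸ u.mem_of_le hu inf_le_left
    rcases (u.mem_sup_iff _ _).1 h3 with h4 | h4
    · exact hau (u.mem_of_le h4 hba)
    · exact u.notMem_of_disjoint hk.disjoint (u.mem_of_le hu inf_le_right)
        (u.mem_of_le h4 hjbk)

end Fixed

/-! ### The complemented subspace `Y_+` -/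

section Projection

variable {A : Type*} [BooleanAlgebra A]

open StoneSpace

theorem single_mem_coordPt {C : BooleanSubalgebra A} {k : A} {n : ℕ} {x : StoneSpace A} :
    Dplus.single C 0 k ∈ (coordPt C n x).carrier ↔ n = 0 ∧ k ∈ x.carrier := by
  show Function.update (⊥ : ℕ → A) 0 k n ∈ x.carrier ↔ _
  rcases eq_or_ne n 0 with rfl | h
  · simp
  · rw [Function.update_of_ne h]
    exact ⟨fun h' => (x.bot_notMem h').elim, fun h' => (h h'.1).elim⟩

/-- The projection of `X_+` onto `Y_+` by multiplication with an indicator function. -/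
noncomputable def projY (C : BooleanSubalgebra A) (k : A) : Xplus C →L[ℝ] Xplus C :=
  ContinuousLinearMap.mul ℝ _ (1 - ind (Dplus.single C 0 k))

theorem projY_apply {C : BooleanSubalgebra A} {k : A} (f : Xplus C) (u : Kplus C) :
    projY C k f u = (1 - ind (Dplus.single C 0 k) u) * f u := rfl

theorem projY_mem {C : BooleanSubalgebra A} {k : A} (f : Xplus C) : projY C k f ∈ Yplus C k := by
  intro u hu
  rw [projY_apply, ind_of_mem hu, sub_self, zero_mul]

theorem projY_eq_self {C : BooleanSubalgebra A} {k : A} {f : Xplus C} (hf : f ∈ Yplus C k) :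
    projY C k f = f := by
  ext u
  rw [projY_apply]
  by_cases hu : Dplus.single C 0 k ∈ u.carrier
  · rw [hf u hu, mul_zero]
  · rw [ind_of_notMem hu, sub_zero, one_mul]

theorem coord_projY {C : BooleanSubalgebra A} {k : A} (f : Xplus C) (n : ℕ) (x : StoneSpace A)
    [Decidable (n = 0 ∧ k ∈ x.carrier)] :
    coord C n (projY C k f) x = if n = 0 ∧ k ∈ x.carrier then 0 else coord C n f x := by
  show (1 - ind (Dplus.single C 0 k) (coordPt C n x)) * coord C n f x = _
  split_ifs with h
  · rw [ind_of_mem (single_mem_coordPt.2 h), sub_self, zero_mul]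
  · rw [ind_of_notMem fun h' => h (single_mem_coordPt.1 h'), sub_zero, one_mul]

theorem eventually_coord_emb_ind {C : BooleanSubalgebra A} (n l : ℕ) (x : StoneSpace A) :
    ∀ᶠ c : C in germs (res C x), coord C n (emb C l (ind (c : A))) x = if n = l then 1 else 0 := by
  filter_upwards [eventually_mem_of_res x] with c hc
  rw [coord_emb]
  split_ifs
  · exact ind_of_mem hc
  · rfl

end Projection

/-- Here `K = StoneSpace A`, `K_{i,*} = [kᵢ]` and `C = fixedAlgebra B j`. -/
theorem mainTheorem2 {A : Type*} [BooleanAlgebra A] (hinf : Infinite A)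
    (hsep : TopologicalSpace.SeparableSpace (StoneSpace A))
    (hperf : PerfectSpace (StoneSpace A))
    (hfew : HasFewOperators (StoneSpace A))
    (hlinfty : ¬ ContainsLinfty C(StoneSpace A, ℝ))
    (hsup : ∀ a : ℕ → A, (Pairwise fun m n => Disjoint (a m) (a n)) →
      ∃ M : Set ℕ, M.Infinite ∧ ∃ s : A, IsLUB (a '' M) s)
    (k₁ k₂ : A) (hk : IsCompl k₁ k₂)
    (B : BooleanSubalgebra A) (hdense : ∀ a : A, a ≠ ⊥ → ∃ b ∈ B, b ≠ ⊥ ∧ b ≤ a)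
    (hk₁ : k₁ ∈ B) (hk₂ : k₂ ∈ B)
    (j : B ≃o B) (hj₁ : j ⟨k₁, hk₁⟩ = ⟨k₂, hk₂⟩) (hj₂ : j ⟨k₂, hk₂⟩ = ⟨k₁, hk₁⟩)
    (hjj : ∀ b : B, j (j b) = b) :
    IsEmpty (Yplus (fixedAlgebra B j) k₁ ≃L[ℝ] Xplus (fixedAlgebra B j)) := by
  classical
  refine ⟨fun T => ?_⟩
  set C := fixedAlgebra B j
  let U : Xplus C →L[ℝ] Xplus C := (T : Yplus C k₁ →L[ℝ] Xplus C).comp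
    ((projY C k₁).codRestrict (Yplus C k₁) projY_mem)
  let V : Xplus C →L[ℝ] Xplus C := (Yplus C k₁).subtypeL.comp
    (T.symm : Xplus C →L[ℝ] Yplus C k₁)
  have hUV : ∀ f, U (V f) = f := fun f => by
    have h1 : (⟨projY C k₁ (T.symm f : Xplus C), projY_mem _⟩ : Yplus C k₁) = T.symm f :=
      Subtype.ext (projY_eq_self (T.symm f).2)
    show T ⟨projY C k₁ (T.symm f : Xplus C), projY_mem _⟩ = f
    rw [h1, T.apply_symm_apply]
  have hVU : ∀ f, V (U f) = projY C k₁ f := fun f => by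
    show ((T.symm (T ⟨projY C k₁ f, projY_mem f⟩) : Yplus C k₁) : Xplus C) = _
    rw [T.symm_apply_apply]
  obtain ⟨φ, hφ⟩ := exists_symbol hfew U
  obtain ⟨φ', hφ'⟩ := exists_symbol hfew V
  have hmulUV := countable_not_mul hlinfty hsup hφ hφ' (fun n l _ => if n = l then 1 else 0)
    fun n l x => tendsto_const_nhds.congr' (by
      filter_upwards [eventually_coord_emb_ind n l x] with c hc
      rw [hUV, hc])
  have hmulVU := countable_not_mul hlinfty hsup hφ' hφ
    (fun n l x => if n = 0 ∧ k₁ ∈ x.carrier then 0 else if n = l then 1 else 0)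
    fun n l x => tendsto_const_nhds.congr' (by
      filter_upwards [eventually_coord_emb_ind n l x] with c hc
      rw [hVU, coord_projY, hc])
  set r : ℝ := max ‖U‖ ‖V‖ with hr
  have hr0 : 0 ≤ r := (norm_nonneg U).trans (le_max_left _ _)
  set ε : ℝ := 1 / (r + 1) with hε
  have hε0 : 0 < ε := by positivity
  have hεr : ε * r < 1 := by
    rw [hε, div_mul_eq_mul_div, one_mul, div_lt_one (by positivity)]
    linarith
  have hclose := countable_not_eventually_tsum_le hsup hφ hε0
  have hA : Nontrivial A := by infer_instance
  have hC : Nontrivial C := ⟨⊥, ⊤, fun h => bot_ne_top (congrArg Subtype.val h : (⊥ : A) = ⊤)⟩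
  obtain ⟨z, hz⟩ := exists_notMem_of_countable
    (fixedAlgebra_atomless hperf hdense hk hk₁ hk₂ hj₁ hjj)
    ((((hφ.union hφ').union hmulUV).union hmulVU).union hclose)
  simp only [Set.mem_union, not_or] at hz
  obtain ⟨⟨⟨⟨hzU, hzV⟩, hzUV⟩, hzVU⟩, hzc⟩ := hz
  replace hzU : IsSymbolAt U φ z := not_not.1 hzU
  replace hzV : IsSymbolAt V φ' z := not_not.1 hzV
  replace hzUV := not_not.1 hzUV
  replace hzVU := not_not.1 hzVU
  replace hzc := not_not.1 hzc
  have hzbot : ∀ c ∈ z.carrier, (c : A) ≠ ⊥ := fun c hc h =>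
    z.bot_notMem ((Subtype.ext h : c = ⊥) ▸ hc)
  obtain ⟨x, hx, hxz⟩ := StoneSpace.exists_res_eq C z k₁ fun c hc =>
    inf_ne_bot_of_mem_fixedAlgebra hk hk₁ hk₂ hj₁ c.2 (hzbot c hc)
  obtain ⟨y, hy, hyz⟩ := StoneSpace.exists_res_eq C z k₂ fun c hc =>
    inf_ne_bot_of_mem_fixedAlgebra hk.symm hk₂ hk₁ hj₂ c.2 (hzbot c hc)
  have hy₁ : k₁ ∉ y.carrier := y.notMem_of_disjoint hk.symm.disjoint hy
  obtain ⟨N, hN⟩ := hzc x y hxz hyz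
  have hUx : IsSymbolAt U φ (StoneSpace.res C x) := hxz ▸ hzU
  have hVx : IsSymbolAt V φ' (StoneSpace.res C x) := hxz ▸ hzV
  have hUy : IsSymbolAt U φ (StoneSpace.res C y) := hyz ▸ hzU
  have hVy : IsSymbolAt V φ' (StoneSpace.res C y) := hyz ▸ hzV
  refine not_rows_close (a := fun n m => φ n m x) (a' := fun n m => φ' n m x)
    (b := fun n m => φ n m y) (b' := fun n m => φ' n m y) (r := r)
    hUx.summable (fun n => (hUx.tsum_abs_le n).trans (le_max_left _ _))
    hVx.summable (fun n => (hVx.tsum_abs_le n).trans (le_max_right _ _))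
    hUy.summable (fun n => (hUy.tsum_abs_le n).trans (le_max_left _ _))
    hVy.summable (fun n => (hVy.tsum_abs_le n).trans (le_max_right _ _))
    (hzUV x hxz) (fun n l => ?_) (hzUV y hyz) (fun n l => ?_) hε0.le hεr hN
  · have := hzVU x hxz n l
    simpa only [hx, and_true] using this
  · have := hzVU y hyz n l
    simpa only [hy₁, and_false, if_false] using this
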